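/- Let $H$ be a smooth (Hausdorff) manifold of dimension $n+1$ with a smooth Riemannian metric $g$, and let $\mathcal W\subset H$ be a compact smoothly embedded hypersurface with unit normal field $\nu$, whose mean curvature $\operatorname{tr} g(\nabla_{\cdot}\,\cdot,\nu)$ with respect to $\nu$ is positive everywhere (so that a round sphere has positive mean curvature with respect to its inner normal). Let $\Phi:(-\sigma,\sigma)\times\mathcal W\to H$, $\sigma>0$, be the normal Fermi decomposition along $\mathcal W$: a diffeomorphism onto an open subset with $\Phi(0,p)=p$, $\partial_t\Phi(0,p)=\nu(p)$ and $\Phi^*g=dt^2+g_t$, where $g_t$ is the metric on $\mathcal W$ induced by $p\mapsto\Phi(t,p)$. The side $t\ge 0$ is the one that is kept; the side $t<0$ of $\mathcal W$ is discarded. For $k,\delta>0$ let $\mathcal H(k,\delta)$ be the set of smooth even functions $h:\mathbb R\to(0,\infty)$ with $h(t)=-t$ for $t\le-\delta$, $h(t)=t$ for $t\ge\delta$, $|h'|\le 1$, $h''\ge 0$, $|h''|\ge k\,|h'+1|$ on $(-\infty,0]$ and $|h''|\ge k\,|h'-1|$ on $[0,\infty)$. Then there are $\sigma_1\in(0,\sigma]$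 and $k_0>0$ such that for all $k\ge k_0$ the following holds. 1. For every $\delta\in(0,\sigma_1/2)$ and every $h\in\mathcal H(k,\delta)$, the metric obtained from $g$ on the kept side by replacing $dt^2+g_t$ by $dt^2+g_{h(t)}$ on $[0,\sigma)\times\mathcal W$ extends to a smooth Riemannian metric $g'$ on $H$ (that is, $\Phi^*g'=dt^2+g_{h(t)}$ on $[0,\sigma)\times\mathcal W$), with $g'=g$ outside $\Phi((-\delta,\delta)\times\mathcal W)$, such that $\operatorname{scal}(g')\ge\operatorname{scal}(g)$ at all points of $H\setminus\Phi((-\delta,0)\times\mathcal W)$, in particular on $\Phi([0,\sigma)\times\mathcal W)$, and $\mathcal W$ is totally geodesic with respect to $g'$. 2. For every neighborhood $U$ of $\mathcal W$ in $H$ there are $\delta\in(0,\sigma_1/2)$, $h\in\mathcal H(k,\delta)$ and a metric $g'$ with all the properties in 1 such that moreover $g'=g$ on $H\setminus U$. -/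

import Mathlib

open scoped Manifold ContDiff Topology

noncomputable section

namespace FermiDoubling

/-! ### Curvature of a metric in coordinates

`γ` is a field of bilinear forms on a finite-dimensional vector space `E` (the coordinate space). -/

section Coordinates

variable {E : Type*} [NormedAddCommGroup E] [NormedSpace ℝ E] [FiniteDimensional ℝ E]

/-- The Christoffel map `Γ_y(v, w) = Γ^k_{ij} v^i w^j ∂_k` of the Levi-Civita connection of `γ`:
the vector `u` with `γ(u, z) = (1/2) (∂_v γ(w, z) + ∂_w γ(v, z) - ∂_z γ(v, w))` for all `z`. -/
def christoffel (γ : E → E →L[ℝ] E →L[ℝ] ℝ) (y v w : E) : E :=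
  (γ y).inverse ((1 / 2 : ℝ) •
    (fderiv ℝ γ y v w + fderiv ℝ γ y w v - ((fderiv ℝ γ y).flip v).flip w))

/-- The Riemann curvature tensor `R(u, v) w = ∇_u ∇_v w - ∇_v ∇_u w` (for constant coordinate
fields `u, v, w`). -/
def riemann (γ : E → E →L[ℝ] E →L[ℝ] ℝ) (y u v w : E) : E :=
  fderiv ℝ (fun y' => christoffel γ y' v w) y u - fderiv ℝ (fun y' => christoffel γ y' u w) y v
    + christoffel γ y u (christoffel γ y v w) - christoffel γ y v (christoffel γ y u w)

/-- The Ricci tensor `Ric(v, w)`, the trace of `u ↦ R(u, v) w`. -/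
def ricci (γ : E → E →L[ℝ] E →L[ℝ] ℝ) (y v w : E) : ℝ :=
  ∑ i, (Module.finBasis ℝ E).coord i (riemann γ y (Module.finBasis ℝ E i) v w)

/-- The trace `∑ i j, γ^{ij} B(e_i, e_j)` of a bilinear form `B` with respect to a scalar product
`γ`, where `γ^{ij} = e^i (γ⁻¹ e^j)` is the inverse matrix of `γ(e_i, e_j)`. -/
def metricTrace (γ : E →L[ℝ] E →L[ℝ] ℝ) (B : E → E → ℝ) : ℝ :=
  ∑ i, ∑ j, (Module.finBasis ℝ E).coord i
      (γ.inverse (LinearMap.toContinuousLinearMap ((Module.finBasis ℝ E).coord j))) *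
    B (Module.finBasis ℝ E i) (Module.finBasis ℝ E j)

/-- Scalar curvature in coordinates. -/
def scalCoord (γ : E → E →L[ℝ] E →L[ℝ] ℝ) (y : E) : ℝ :=
  metricTrace (γ y) (ricci γ y)

end Coordinates

/-! ### Riemannian manifolds and hypersurfaces -/

section Manifold

variable {m n : ℕ}
  {H : Type*} [TopologicalSpace H] [ChartedSpace (EuclideanSpace ℝ (Fin m)) H]
  [IsManifold (𝓡 m) ∞ H]
  {W : Type*} [TopologicalSpace W] [ChartedSpace (EuclideanSpace ℝ (Fin n)) W]

variable (m H) in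
/-- Smooth Riemannian metrics on the manifold `H`. -/
abbrev Metric : Type _ :=
  Bundle.ContMDiffRiemannianMetric (𝓡 m) ∞ (EuclideanSpace ℝ (Fin m))
    (fun x : H => TangentSpace (𝓡 m) x)

/-- The coordinate expression `g_{ij}` of the metric `g` in the preferred chart at `x`. -/
def coordMetric (g : Metric m H) (x : H) (y : EuclideanSpace ℝ (Fin m)) :
    EuclideanSpace ℝ (Fin m) →L[ℝ] EuclideanSpace ℝ (Fin m) →L[ℝ] ℝ :=
  ContinuousLinearMap.bilinearComp
    (E := EuclideanSpace ℝ (Fin m)) (F := EuclideanSpace ℝ (Fin m))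
    (g.inner ((extChartAt (𝓡 m) x).symm y))
    (mfderiv 𝓘(ℝ, EuclideanSpace ℝ (Fin m)) (𝓡 m) (extChartAt (𝓡 m) x).symm y)
    (mfderiv 𝓘(ℝ, EuclideanSpace ℝ (Fin m)) (𝓡 m) (extChartAt (𝓡 m) x).symm y)

/-- The scalar curvature of `g` at `x`. -/
def scal (g : Metric m H) (x : H) : ℝ :=
  scalCoord (coordMetric g x) (extChartAt (𝓡 m) x x)

/-- The second derivative `∇dι(v, w)` of a map `ι : W → H` at `p`, a vector tangent to `H` at
`ι p`, for `v, w` tangent to `W` at `p`; in coordinates it is `∂_v ∂_w ι + Γ(∂_v ι, ∂_w ι)`.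
Modulo vectors tangent to the hypersurface it is the covariant derivative `∇_v w` of `H`.
Tangent vectors at a point are, as always in Mathlib, written in the preferred chart there. -/
def secondDeriv (g : Metric m H) (ι : W → H) (p : W) (v w : TangentSpace (𝓡 n) p) :
    TangentSpace (𝓡 m) (ι p) :=
  let f : EuclideanSpace ℝ (Fin n) → EuclideanSpace ℝ (Fin m) :=
    writtenInExtChartAt (𝓡 n) (𝓡 m) p ι
  let y : EuclideanSpace ℝ (Fin n) := extChartAt (𝓡 n) p p
  (fderiv ℝ (fun y' => fderiv ℝ f y' w) y v
    + christoffel (coordMetric g (ι p)) (f y) (fderiv ℝ f y v) (fderiv ℝ f y w) :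
      EuclideanSpace ℝ (Fin m))

/-- The hypersurface `ι : W → H` is totally geodesic: its second fundamental form, the normal part
of `∇_v w` for tangent `v, w`, vanishes. -/
def IsTotallyGeodesic (g : Metric m H) (ι : W → H) : Prop :=
  ∀ (p : W) (v w : TangentSpace (𝓡 n) p),
    secondDeriv g ι p v w ∈ Set.range (mfderiv (𝓡 n) (𝓡 m) ι p)

/-- The metric induced by `g` on `W` by the immersion `ι`, at the point `p`. -/
def inducedMetric (g : Metric m H) (ι : W → H) (p : W) :
    EuclideanSpace ℝ (Fin n) →L[ℝ] EuclideanSpace ℝ (Fin n) →L[ℝ] ℝ :=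
  ContinuousLinearMap.bilinearComp
    (E := EuclideanSpace ℝ (Fin m)) (F := EuclideanSpace ℝ (Fin m))
    (g.inner (ι p)) (mfderiv (𝓡 n) (𝓡 m) ι p) (mfderiv (𝓡 n) (𝓡 m) ι p)

/-- The mean curvature of the hypersurface `ι` with respect to the unit normal field `ν`: the trace
of the second fundamental form `(v, w) ↦ g(∇_v w, ν)`. For a round sphere in Euclidean space it is
positive when `ν` points inwards. -/
def meanCurvature (g : Metric m H) (ι : W → H) (ν : ∀ p : W, TangentSpace (𝓡 m) (ι p)) (p : W) :
    ℝ :=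
  metricTrace (inducedMetric (n := n) g ι p)
    (fun v w => g.inner (ι p) (secondDeriv (n := n) g ι p v w) (ν p))

/-! ### Fermi decompositions -/

/-- The coordinate field `∂/∂t` of a map `Φ : ℝ × W → H`. -/
def dt (Φ : ℝ × W → H) (t : ℝ) (p : W) : TangentSpace (𝓡 m) (Φ (t, p)) :=
  mfderiv 𝓘(ℝ, ℝ) (𝓡 m) (fun s : ℝ => Φ (s, p)) t (1 : ℝ)

/-- The differential of the slice `p ↦ Φ (t, p)`. -/
def dslice (Φ : ℝ × W → H) (t : ℝ) (p : W) (v : TangentSpace (𝓡 n) p) :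
    TangentSpace (𝓡 m) (Φ (t, p)) :=
  mfderiv (𝓡 n) (𝓡 m) (fun q : W => Φ (t, q)) p v

/-- The metric `g_t` on `W` obtained by restricting `g` to the slice `N_t = Φ ({t} × W)`. -/
def sliceMetric (g : Metric m H) (Φ : ℝ × W → H) (t : ℝ) (p : W) (v w : TangentSpace (𝓡 n) p) :
    ℝ :=
  g.inner (Φ (t, p)) (dslice Φ t p v) (dslice Φ t p w)

/-- The pull-back of `g` by `Φ` is `dt² + γ t` at all points of `T × W`. -/
def HasForm (g : Metric m H) (Φ : ℝ × W → H) (T : Set ℝ)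
    (γ : ℝ → ∀ p : W, TangentSpace (𝓡 n) p → TangentSpace (𝓡 n) p → ℝ) : Prop :=
  ∀ t ∈ T, ∀ p : W,
    g.inner (Φ (t, p)) (dt Φ t p) (dt Φ t p) = 1 ∧
    (∀ v, g.inner (Φ (t, p)) (dt Φ t p) (dslice (n := n) Φ t p v) = 0) ∧
    ∀ v w, g.inner (Φ (t, p)) (dslice (n := n) Φ t p v) (dslice (n := n) Φ t p w) = γ t p v w

/-- `Φ` is the normal Fermi decomposition of width `σ` along the hypersurface `ι` with unit normal
field `ν`: a diffeomorphism of `(-σ, σ) × W` onto an open subset of `H`, starting on `W` with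
velocity `ν`, in which the metric is `dt² + g_t`. -/
structure IsFermi (g : Metric m H) (ι : W → H) (ν : ∀ p : W, TangentSpace (𝓡 m) (ι p))
    (σ : ℝ) (Φ : ℝ × W → H) : Prop where
  pos : 0 < σ
  isLocalDiffeomorphOn :
    IsLocalDiffeomorphOn (𝓘(ℝ, ℝ).prod (𝓡 n)) (𝓡 m) ∞ Φ (Set.Ioo (-σ) σ ×ˢ Set.univ)
  injOn : Set.InjOn Φ (Set.Ioo (-σ) σ ×ˢ Set.univ)
  initial : ∀ p : W,
    tangentMap 𝓘(ℝ, ℝ) (𝓡 m) (fun t : ℝ => Φ (t, p)) ⟨0, (1 : ℝ)⟩ = ⟨ι p, ν p⟩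
  hasForm : HasForm g Φ (Set.Ioo (-σ) σ) (sliceMetric (n := n) g Φ)

end Manifold

/-- The reparametrizing functions `h` with constants `k` and `δ`. -/
structure IsCompression (k δ : ℝ) (h : ℝ → ℝ) : Prop where
  smooth : ContDiff ℝ ∞ h
  pos : ∀ t, 0 < h t
  left : ∀ t, t ≤ -δ → h t = -t
  right : ∀ t, δ ≤ t → h t = t
  even : ∀ t, h (-t) = h t
  abs_deriv_le : ∀ t, |deriv h t| ≤ 1
  convex : ∀ t, 0 ≤ deriv (deriv h) t
  growth_left : ∀ t, t ≤ 0 → k * |deriv h t + 1| ≤ |deriv (deriv h) t|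
  growth_right : ∀ t, 0 ≤ t → k * |deriv h t - 1| ≤ |deriv (deriv h) t|

/-- The metric `g'` arises from `g` by replacing `dt² + g_t` by `dt² + g_{h(t)}` on `[0, σ) × W`;
it is unchanged off the part `Φ ((-δ, δ) × W)` of the Fermi neighbourhood, and on the discarded
side `t < 0` it is any smooth continuation. -/
structure IsReplacement {m n : ℕ}
    {H : Type*} [TopologicalSpace H] [ChartedSpace (EuclideanSpace ℝ (Fin m)) H]
    [IsManifold (𝓡 m) ∞ H]
    {W : Type*} [TopologicalSpace W] [ChartedSpace (EuclideanSpace ℝ (Fin n)) W]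
    (g : Metric m H) (Φ : ℝ × W → H) (σ δ : ℝ) (h : ℝ → ℝ) (g' : Metric m H) : Prop where
  hasForm : HasForm g' Φ (Set.Ico 0 σ) (fun t => sliceMetric (n := n) g Φ (h t))
  eq_off : ∀ x, x ∉ Φ '' (Set.Ioo (-δ) δ ×ˢ Set.univ) → g'.inner x = g.inner x

end FermiDoubling

end

open scoped Manifold ContDiff Topology

set_option linter.unusedSectionVars false
set_option maxSynthPendingDepth 3

noncomputable section

/-! In Fermi coordinates the metric is a matrix field G(t, y) = dt² + g_t. The second jet of G(h(t),
y) sees h only through h, h' and h'', and h'' enters only through the summand h'' dt ⊗ dt ⊗ ∂_t G of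
the second derivative. Scalar curvature is affine in the second derivatives of the metric, and this
summand contributes -h'' tr(∂_t g), taken at the parameter h(t) (`scalJet_add`). Hence
(`scalCoord_warp`) the new scalar curvature is S(h(t), y, h'(t)) - h'' tr(∂_t g), where S =
`scalWarp` is C¹ and S(t, y, 1) is the old scalar curvature. No splitting into intrinsic and
extrinsic curvature of the slices is needed.

The mean curvature is -1/2 tr(∂_t g) at t = 0 (`IsFermi.meanCurvature_eq`), so its positivity makes
the last term at least c h'' near the hypersurface, with c > 0. Convexity of h gives 0 ≤ h(t) - t ≤
δ (1 - h'(t)) on [0, δ] (`IsCompression.estimates`), so for δ ≤ 1 the value of S changes by at most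
L (1 - h'), L being a Lipschitz constant. The growth condition h'' ≥ k (1 - h') absorbs this loss as
soon as k c ≥ L (`exists_scalCoord_le_warp`). Compactness of `W` makes all constants uniform
(`IsFermi.exists_scalIncreases`). Since `scal` is defined in the preferred chart at each point,
coordinate invariance of scalar curvature (`scal_eq_scalCoord_pullback`) carries the estimate to
`H`.

An even h has h'(0) = 0, so the t-derivative of the new metric, and with it the second fundamental
form of the slice t = 0, vanishes there (`IsFermi.isTotallyGeodesic_bent`). A smooth metric on all
of `H` comes from a function η that agrees with h on a neighbourhood of [0, ∞) and is the identity
below -δ/2 (`IsCompression.exists_extension`, `IsFermi.exists_bentMetric`). The second claim also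
needs compressions of arbitrarily small width: integrating an even bump twice gives one whenever k δ
≤ 1 (`exists_isCompression`). -/

namespace FermiDoubling

/-! ### Curvature in coordinates as multilinear algebra in the metric and its derivatives -/

section Coordinates

variable {E F : Type*} [NormedAddCommGroup E] [NormedSpace ℝ E]
  [NormedAddCommGroup F] [NormedSpace ℝ F]

/-- The Christoffel symbols of the first kind, as a linear function of the derivative of the
metric. -/
def lowerChristoffel :
    (E →L[ℝ] E →L[ℝ] E →L[ℝ] ℝ) →L[ℝ] (E →L[ℝ] E →L[ℝ] E →L[ℝ] ℝ) :=
  let fl : (E →L[ℝ] E →L[ℝ] E →L[ℝ] ℝ) →L[ℝ] (E →L[ℝ] E →L[ℝ] E →L[ℝ] ℝ) :=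
    (ContinuousLinearMap.flipₗᵢ ℝ E E (E →L[ℝ] ℝ)).toContinuousLinearEquiv.toContinuousLinearMap
  let fl' : (E →L[ℝ] E →L[ℝ] ℝ) →L[ℝ] (E →L[ℝ] E →L[ℝ] ℝ) :=
    (ContinuousLinearMap.flipₗᵢ ℝ E E ℝ).toContinuousLinearEquiv.toContinuousLinearMap
  (1 / 2 : ℝ) • (ContinuousLinearMap.id ℝ _ + fl -
    (ContinuousLinearMap.compL ℝ E (E →L[ℝ] E →L[ℝ] ℝ) (E →L[ℝ] E →L[ℝ] ℝ) fl').comp fl)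

theorem lowerChristoffel_apply (d : E →L[ℝ] E →L[ℝ] E →L[ℝ] ℝ) (v w z : E) :
    lowerChristoffel d v w z = (1 / 2 : ℝ) * (d v w z + d w v z - d z v w) := by
  simp [lowerChristoffel]

/-- The Christoffel map in terms of the metric and its derivative. -/
def christoffelOf (g : E →L[ℝ] E →L[ℝ] ℝ) (d : E →L[ℝ] E →L[ℝ] E →L[ℝ] ℝ) :
    E →L[ℝ] E →L[ℝ] E :=
  (ContinuousLinearMap.compL ℝ E (E →L[ℝ] ℝ) E g.inverse).comp (lowerChristoffel d)

theorem christoffelOf_apply (g : E →L[ℝ] E →L[ℝ] ℝ) (d : E →L[ℝ] E →L[ℝ] E →L[ℝ] ℝ) (v w : E) :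
    christoffelOf g d v w = g.inverse (lowerChristoffel d v w) := rfl

/-- `inverse` takes the default value 0 at maps that are not invertible, so every curvature identity
below carries an invertibility hypothesis on the metric. -/
theorem apply_inverse_apply {g : E →L[ℝ] F} (hg : g.IsInvertible) (x : F) :
    g (g.inverse x) = x := by
  obtain ⟨e, rfl⟩ := hg
  simp

theorem inverse_apply_apply {g : E →L[ℝ] F} (hg : g.IsInvertible) (x : E) :
    g.inverse (g x) = x := by
  obtain ⟨e, rfl⟩ := hg
  simp

variable [FiniteDimensional ℝ E] [FiniteDimensional ℝ F]

theorem christoffel_eq (γ : E → E →L[ℝ] E →L[ℝ] ℝ) (y v w : E) :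
    christoffel γ y v w = christoffelOf (γ y) (fderiv ℝ γ y) v w := by
  rw [christoffel, christoffelOf_apply]
  congr 1

theorem metric_christoffel {γ : E → E →L[ℝ] E →L[ℝ] ℝ} {y : E} (hg : (γ y).IsInvertible)
    (v w z : E) : γ y (christoffel γ y v w) z =
      (1 / 2 : ℝ) * (fderiv ℝ γ y v w z + fderiv ℝ γ y w v z - fderiv ℝ γ y z v w) := by
  rw [christoffel_eq, christoffelOf_apply, apply_inverse_apply hg, lowerChristoffel_apply]

theorem contDiffAt_christoffelOf {n : ℕ∞ω}
    {p : (E →L[ℝ] E →L[ℝ] ℝ) × (E →L[ℝ] E →L[ℝ] E →L[ℝ] ℝ)} (hp : p.1.IsInvertible) :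
    ContDiffAt ℝ n (fun q : (E →L[ℝ] E →L[ℝ] ℝ) × (E →L[ℝ] E →L[ℝ] E →L[ℝ] ℝ) =>
      christoffelOf q.1 q.2) p := by
  have h1 : ContDiffAt ℝ n (fun q : (E →L[ℝ] E →L[ℝ] ℝ) × (E →L[ℝ] E →L[ℝ] E →L[ℝ] ℝ) =>
      q.1.inverse) p :=
    (hp.contDiffAt_map_inverse (n := n)).comp p contDiffAt_fst
  exact ((ContinuousLinearMap.contDiff _).contDiffAt.comp p h1).clm_comp
    ((ContinuousLinearMap.contDiff _).contDiffAt.comp p contDiffAt_snd)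

/-- The Christoffel map of a `C²` metric is differentiable. -/
theorem differentiableAt_christoffelOf {γ : E → E →L[ℝ] E →L[ℝ] ℝ} {y : E}
    (hg : (γ y).IsInvertible) (hγ : ContDiffAt ℝ 2 γ y) :
    DifferentiableAt ℝ (fun y' => christoffelOf (γ y') (fderiv ℝ γ y')) y := by
  have h1 : DifferentiableAt ℝ γ y := hγ.differentiableAt (by norm_num)
  have h2 : DifferentiableAt ℝ (fderiv ℝ γ) y :=
    (hγ.fderiv_right (m := 1) (by norm_num)).differentiableAt (by norm_num)
  exact ((contDiffAt_christoffelOf (n := 1) (p := (γ y, fderiv ℝ γ y)) hg).differentiableAt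
    (by norm_num)).comp y (f := fun y' => (γ y', fderiv ℝ γ y')) (h1.prodMk h2)

theorem fderiv_christoffel {γ : E → E →L[ℝ] E →L[ℝ] ℝ} {y : E}
    (hg : (γ y).IsInvertible) (hγ : ContDiffAt ℝ 2 γ y) (u v w : E) :
    fderiv ℝ (fun y' => christoffel γ y' v w) y u =
      fderiv ℝ (fun y' => christoffelOf (γ y') (fderiv ℝ γ y')) y u v w := by
  have h := (differentiableAt_christoffelOf hg hγ).hasFDerivAt
  have h' := (h.clm_apply (hasFDerivAt_const v y)).clm_apply (hasFDerivAt_const w y)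
  simp only [christoffel_eq]
  rw [h'.fderiv]
  simp

/-- The Riemann tensor in terms of the Christoffel map and its derivative. -/
def riemannOf (Γ : E →L[ℝ] E →L[ℝ] E) (DΓ : E →L[ℝ] E →L[ℝ] E →L[ℝ] E) (u v w : E) : E :=
  DΓ u v w - DΓ v u w + Γ u (Γ v w) - Γ v (Γ u w)

theorem riemann_eq {γ : E → E →L[ℝ] E →L[ℝ] ℝ} {y : E}
    (hg : (γ y).IsInvertible) (hγ : ContDiffAt ℝ 2 γ y) (u v w : E) :
    riemann γ y u v w = riemannOf (christoffelOf (γ y) (fderiv ℝ γ y))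
      (fderiv ℝ (fun y' => christoffelOf (γ y') (fderiv ℝ γ y')) y) u v w := by
  simp only [riemann, fderiv_christoffel hg hγ, riemannOf]
  simp only [christoffel_eq]

/-- The Ricci form as a bilinear map. -/
def ricciOf (Γ : E →L[ℝ] E →L[ℝ] E) (DΓ : E →L[ℝ] E →L[ℝ] E →L[ℝ] E) : E →ₗ[ℝ] E →ₗ[ℝ] ℝ :=
  LinearMap.mk₂ ℝ
    (fun v w => ∑ i, (Module.finBasis ℝ E).coord i (riemannOf Γ DΓ (Module.finBasis ℝ E i) v w))
    (fun v v' w => by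
      rw [← Finset.sum_add_distrib]
      refine Finset.sum_congr rfl fun i _ => ?_
      rw [← map_add]; congr 1
      simp only [riemannOf, map_add, add_apply]; abel)
    (fun c v w => by
      rw [smul_eq_mul, Finset.mul_sum]
      refine Finset.sum_congr rfl fun i _ => ?_
      rw [← smul_eq_mul, ← map_smul]; congr 1
      simp only [riemannOf, map_smul, smul_apply, smul_add, smul_sub])
    (fun v w w' => by
      rw [← Finset.sum_add_distrib]
      refine Finset.sum_congr rfl fun i _ => ?_
      rw [← map_add]; congr 1
      simp only [riemannOf, map_add]; abel)
    (fun c v w => by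
      rw [smul_eq_mul, Finset.mul_sum]
      refine Finset.sum_congr rfl fun i _ => ?_
      rw [← smul_eq_mul, ← map_smul]; congr 1
      simp only [riemannOf, map_smul, smul_add, smul_sub])

theorem ricci_eq {γ : E → E →L[ℝ] E →L[ℝ] ℝ} {y : E}
    (hg : (γ y).IsInvertible) (hγ : ContDiffAt ℝ 2 γ y) (v w : E) :
    ricci γ y v w = ricciOf (christoffelOf (γ y) (fderiv ℝ γ y))
      (fderiv ℝ (fun y' => christoffelOf (γ y') (fderiv ℝ γ y')) y) v w := by
  simp only [ricci, riemann_eq hg hγ, ricciOf, LinearMap.mk₂_apply]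

/-- Frees the definitions of `ricci` and `metricTrace` from the basis `Module.finBasis`; invariance
then reduces to invariance of the trace under conjugation. -/
theorem sum_coord_eq_trace (T : E →ₗ[ℝ] E) :
    ∑ i, (Module.finBasis ℝ E).coord i (T (Module.finBasis ℝ E i)) = LinearMap.trace ℝ E T := by
  rw [LinearMap.trace_eq_matrix_trace ℝ (Module.finBasis ℝ E), Matrix.trace]
  simp [LinearMap.toMatrix_apply]

/-- The endomorphism whose trace is the metric trace of a bilinear form. -/
def raise (g : E →L[ℝ] E →L[ℝ] ℝ) (B : E →ₗ[ℝ] E →ₗ[ℝ] ℝ) : E →ₗ[ℝ] E :=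
  g.inverse.toLinearMap ∘ₗ (LinearMap.toContinuousLinearMap (𝕜 := ℝ)).toLinearMap ∘ₗ B

theorem raise_apply (g : E →L[ℝ] E →L[ℝ] ℝ) (B : E →ₗ[ℝ] E →ₗ[ℝ] ℝ) (v : E) :
    raise g B v = g.inverse (LinearMap.toContinuousLinearMap (B v)) := rfl

theorem metricTrace_eq_trace (g : E →L[ℝ] E →L[ℝ] ℝ) (B : E →ₗ[ℝ] E →ₗ[ℝ] ℝ) :
    metricTrace g (fun v w => B v w) = LinearMap.trace ℝ E (raise g B) := by
  rw [← sum_coord_eq_trace, metricTrace]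
  refine Finset.sum_congr rfl fun i _ => ?_
  have h : LinearMap.toContinuousLinearMap (B (Module.finBasis ℝ E i)) =
      ∑ j, B (Module.finBasis ℝ E i) (Module.finBasis ℝ E j) •
        LinearMap.toContinuousLinearMap ((Module.finBasis ℝ E).coord j) := by
    ext x
    conv_lhs => rw [← (Module.finBasis ℝ E).sum_repr x]
    simp only [map_sum, map_smul, LinearMap.coe_toContinuousLinearMap', smul_eq_mul,
      sum_apply, smul_apply, Module.Basis.coord_apply]
    exact Finset.sum_congr rfl fun j _ => mul_comm _ _
  rw [raise_apply, h, map_sum, map_sum]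
  refine Finset.sum_congr rfl fun j _ => ?_
  rw [map_smul, map_smul, smul_eq_mul, mul_comm]

/-- The endomorphism `u ↦ R(u, v) w`. -/
def riemannEndo (Γ : E →L[ℝ] E →L[ℝ] E) (DΓ : E →L[ℝ] E →L[ℝ] E →L[ℝ] E) (v w : E) :
    E →ₗ[ℝ] E where
  toFun u := riemannOf Γ DΓ u v w
  map_add' u u' := by simp only [riemannOf, map_add, add_apply]; abel
  map_smul' c u := by
    simp only [riemannOf, map_smul, smul_apply, smul_add, smul_sub, RingHom.id_apply]

theorem ricciOf_eq_trace (Γ : E →L[ℝ] E →L[ℝ] E) (DΓ : E →L[ℝ] E →L[ℝ] E →L[ℝ] E) (v w : E) :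
    ricciOf Γ DΓ v w = LinearMap.trace ℝ E (riemannEndo Γ DΓ v w) :=
  sum_coord_eq_trace (riemannEndo Γ DΓ v w)

end Coordinates

/-! ### Invariance of scalar curvature under changes of coordinates -/

section Invariance

variable {E F : Type*} [NormedAddCommGroup E] [NormedSpace ℝ E] [FiniteDimensional ℝ E]
  [NormedAddCommGroup F] [NormedSpace ℝ F] [FiniteDimensional ℝ F]

/-- The pull-back of a field of bilinear forms by a map between coordinate spaces. -/
def pullForm (φ : E → F) (γ : F → F →L[ℝ] F →L[ℝ] ℝ) (y : E) : E →L[ℝ] E →L[ℝ] ℝ :=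
  (γ (φ y)).bilinearComp (fderiv ℝ φ y) (fderiv ℝ φ y)

theorem pullForm_apply (φ : E → F) (γ : F → F →L[ℝ] F →L[ℝ] ℝ) (y v w : E) :
    pullForm φ γ y v w = γ (φ y) (fderiv ℝ φ y v) (fderiv ℝ φ y w) := rfl

theorem contDiffAt_bilinearComp {G V : Type*} [NormedAddCommGroup G] [NormedSpace ℝ G]
    [NormedAddCommGroup V] [NormedSpace ℝ V] {n : ℕ∞ω}
    {b : G → F →L[ℝ] F →L[ℝ] V} {A : G → E →L[ℝ] F} {x : G}
    (hb : ContDiffAt ℝ n b x) (hA : ContDiffAt ℝ n A x) :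
    ContDiffAt ℝ n (fun x => (b x).bilinearComp (A x) (A x)) x := by
  let fl' : (E →L[ℝ] F →L[ℝ] V) →L[ℝ] (F →L[ℝ] E →L[ℝ] V) :=
    (ContinuousLinearMap.flipₗᵢ ℝ E F V).toContinuousLinearEquiv.toContinuousLinearMap
  let fl'' : (E →L[ℝ] E →L[ℝ] V) →L[ℝ] (E →L[ℝ] E →L[ℝ] V) :=
    (ContinuousLinearMap.flipₗᵢ ℝ E E V).toContinuousLinearEquiv.toContinuousLinearMap
  have h1 : ContDiffAt ℝ n (fun x => fl' ((b x).comp (A x))) x :=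
    fl'.contDiff.contDiffAt.comp x (hb.clm_comp hA)
  exact fl''.contDiff.contDiffAt.comp x (h1.clm_comp hA)

theorem ContDiffAt.pullForm {n m : ℕ∞ω} (hnm : n + 1 ≤ m) {φ : E → F}
    {γ : F → F →L[ℝ] F →L[ℝ] ℝ} {y : E}
    (hφ : ContDiffAt ℝ m φ y) (hγ : ContDiffAt ℝ n γ (φ y)) :
    ContDiffAt ℝ n (pullForm φ γ) y :=
  contDiffAt_bilinearComp (hγ.comp y (hφ.of_le (le_self_add.trans hnm))) (hφ.fderiv_right hnm)

theorem isInvertible_bilinearComp {g : F →L[ℝ] F →L[ℝ] ℝ} {A : E →L[ℝ] F}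
    (hg : g.IsInvertible) (hA : A.IsInvertible) : (g.bilinearComp A A).IsInvertible := by
  obtain ⟨a, rfl⟩ := hA
  obtain ⟨e, rfl⟩ := hg
  refine ⟨(a.trans e).trans (a.symm.arrowCongr (ContinuousLinearEquiv.refl ℝ ℝ)), ?_⟩
  ext v w
  simp [ContinuousLinearEquiv.arrowCongr_apply]

theorem fderiv_pullForm {φ : E → F} {γ : F → F →L[ℝ] F →L[ℝ] ℝ} {y : E}
    (hφ : ContDiffAt ℝ 2 φ y) (hγ : DifferentiableAt ℝ γ (φ y)) (u v w : E) :
    fderiv ℝ (pullForm φ γ) y u v w =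
      fderiv ℝ γ (φ y) (fderiv ℝ φ y u) (fderiv ℝ φ y v) (fderiv ℝ φ y w)
      + γ (φ y) (fderiv ℝ (fderiv ℝ φ) y u v) (fderiv ℝ φ y w)
      + γ (φ y) (fderiv ℝ φ y v) (fderiv ℝ (fderiv ℝ φ) y u w) := by
  have hφ1 : HasFDerivAt φ (fderiv ℝ φ y) y := (hφ.differentiableAt (by norm_num)).hasFDerivAt
  have hφ2 : HasFDerivAt (fderiv ℝ φ) (fderiv ℝ (fderiv ℝ φ) y) y :=
    ((hφ.fderiv_right (m := 1) (by norm_num)).differentiableAt (by norm_num)).hasFDerivAt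
  have hg := hγ.hasFDerivAt.comp y hφ1
  have hv := hφ2.clm_apply (hasFDerivAt_const v y)
  have hw := hφ2.clm_apply (hasFDerivAt_const w y)
  have h := (hg.clm_apply hv).clm_apply hw
  have hp : DifferentiableAt ℝ (pullForm φ γ) y := by
    have hb : DifferentiableAt ℝ (fun y => (γ (φ y)).comp (fderiv ℝ φ y)) y :=
      (hg.differentiableAt).clm_comp hφ2.differentiableAt
    let fl' : (E →L[ℝ] F →L[ℝ] ℝ) →L[ℝ] (F →L[ℝ] E →L[ℝ] ℝ) :=
      (ContinuousLinearMap.flipₗᵢ ℝ E F ℝ).toContinuousLinearEquiv.toContinuousLinearMap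
    let fl'' : (E →L[ℝ] E →L[ℝ] ℝ) →L[ℝ] (E →L[ℝ] E →L[ℝ] ℝ) :=
      (ContinuousLinearMap.flipₗᵢ ℝ E E ℝ).toContinuousLinearEquiv.toContinuousLinearMap
    exact fl''.differentiableAt.comp y
      ((fl'.differentiableAt.comp y hb).clm_comp hφ2.differentiableAt)
  have h' := (hp.hasFDerivAt.clm_apply (hasFDerivAt_const v y)).clm_apply (hasFDerivAt_const w y)
  have key := congrArg (fun L : E →L[ℝ] ℝ => L u) (h'.unique h)
  simp at key
  rw [key]; ring

/-- The transformation law of the Christoffel symbols. -/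
theorem fderiv_christoffel_pullForm {φ : E → F} {γ : F → F →L[ℝ] F →L[ℝ] ℝ} {y : E}
    (hφ : ContDiffAt ℝ 2 φ y) (hA : (fderiv ℝ φ y).IsInvertible)
    (hγ : DifferentiableAt ℝ γ (φ y)) (hsymm : ∀ v w, γ (φ y) v w = γ (φ y) w v)
    (hg : (γ (φ y)).IsInvertible) (v w : E) :
    fderiv ℝ φ y (christoffel (pullForm φ γ) y v w) =
      fderiv ℝ (fderiv ℝ φ) y v w + christoffel γ (φ y) (fderiv ℝ φ y v) (fderiv ℝ φ y w) := by
  -- By nondegeneracy it is enough to pair both sides with vectors `fderiv ℝ φ y z`; the Koszul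
  -- formula then applies on either side.
  have hinj : Function.Injective (γ (φ y)) := by
    obtain ⟨e, he⟩ := hg
    rw [← he]; exact e.injective
  apply hinj
  ext z'
  obtain ⟨z, rfl⟩ : ∃ z, fderiv ℝ φ y z = z' := by
    obtain ⟨a, ha⟩ := hA
    rw [← ha]; exact a.surjective z'
  rw [← pullForm_apply, metric_christoffel (isInvertible_bilinearComp hg hA), map_add,
    add_apply, metric_christoffel hg]
  simp only [fderiv_pullForm hφ hγ]
  have hs : ∀ a b, fderiv ℝ (fderiv ℝ φ) y a b = fderiv ℝ (fderiv ℝ φ) y b a := fun a b =>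
    (hφ.isSymmSndFDerivAt (by simp)).eq a b
  rw [hs w v, hs z v, hs z w, hsymm (fderiv ℝ (fderiv ℝ φ) y v z),
    hsymm (fderiv ℝ φ y v) (fderiv ℝ (fderiv ℝ φ) y w z)]
  ring

/-- The Riemann tensor of a pull-back is the pull-back of the Riemann tensor. -/
theorem fderiv_riemann_pullForm {φ : E → F} {γ : F → F →L[ℝ] F →L[ℝ] ℝ} {y : E}
    (hφ : ContDiffAt ℝ 3 φ y) (hA : (fderiv ℝ φ y).IsInvertible)
    (hγ : ContDiffAt ℝ 2 γ (φ y)) (hsymm : ∀ᶠ x in 𝓝 (φ y), ∀ v w, γ x v w = γ x w v)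
    (hg : (γ (φ y)).IsInvertible) (u v w : E) :
    fderiv ℝ φ y (riemann (pullForm φ γ) y u v w) =
      riemann γ (φ y) (fderiv ℝ φ y u) (fderiv ℝ φ y v) (fderiv ℝ φ y w) := by
  have hφ2 : ContDiffAt ℝ 2 φ y := hφ.of_le (by norm_num)
  have hcont : ContinuousAt φ y := hφ.continuousAt
  have hdφ : ContDiffAt ℝ 2 (fderiv ℝ φ) y := hφ.fderiv_right (by norm_num)
  have hddφ : ContDiffAt ℝ 1 (fderiv ℝ (fderiv ℝ φ)) y := hdφ.fderiv_right (by norm_num)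
  have e1 : ∀ᶠ y' in 𝓝 y, ContDiffAt ℝ 2 φ y' := hφ2.eventually (by simp)
  have e2 : ∀ᶠ y' in 𝓝 y, (fderiv ℝ φ y').IsInvertible := by
    obtain ⟨a, ha⟩ := hA
    have := ContinuousLinearEquiv.nhds a
    rw [ha] at this
    filter_upwards [hdφ.continuousAt this] with y' hy'
    exact hy'
  have e3 : ∀ᶠ y' in 𝓝 y, ContDiffAt ℝ 2 γ (φ y') := hcont (hγ.eventually (by simp))
  have e4 : ∀ᶠ y' in 𝓝 y, (γ (φ y')).IsInvertible := by
    obtain ⟨a, ha⟩ := hg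
    have := ContinuousLinearEquiv.nhds a
    rw [ha] at this
    filter_upwards [hcont (hγ.continuousAt this)] with y' hy'
    exact hy'
  have e5 := hcont hsymm
  -- The Christoffel transformation law is to be differentiated, so it is needed on a neighbourhood,
  -- where smoothness and invertibility persist. After antisymmetrization in u, v the second and
  -- third derivatives of φ cancel by their symmetry.
  have law : ∀ v w, (fun y' => fderiv ℝ φ y' (christoffel (pullForm φ γ) y' v w)) =ᶠ[𝓝 y]
      fun y' => fderiv ℝ (fderiv ℝ φ) y' v w +
        christoffel γ (φ y') (fderiv ℝ φ y' v) (fderiv ℝ φ y' w) := by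
    intro v w
    filter_upwards [e1, e2, e3, e4, e5] with y' h1 h2 h3 h4 h5
    exact fderiv_christoffel_pullForm h1 h2 (h3.differentiableAt (by norm_num)) h5 h4 v w
  have hp : ContDiffAt ℝ 2 (pullForm φ γ) y := ContDiffAt.pullForm (by norm_num) hφ hγ
  have hpi : (pullForm φ γ y).IsInvertible := isInvertible_bilinearComp hg hA
  have hA1 := (hdφ.differentiableAt (by norm_num)).hasFDerivAt
  have hA2 := (hddφ.differentiableAt (by norm_num)).hasFDerivAt
  have hφ1 := (hφ.differentiableAt (by norm_num)).hasFDerivAt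
  have hΓ := (differentiableAt_christoffelOf hg hγ).hasFDerivAt
  have hΓ' := (differentiableAt_christoffelOf hpi hp).hasFDerivAt
  have der : ∀ u v w, fderiv ℝ (fderiv ℝ φ) y u (christoffel (pullForm φ γ) y v w) +
      fderiv ℝ φ y (fderiv ℝ (fun y' => christoffel (pullForm φ γ) y' v w) y u) =
      fderiv ℝ (fderiv ℝ (fderiv ℝ φ)) y u v w +
      (fderiv ℝ (fun x => christoffel γ x (fderiv ℝ φ y v) (fderiv ℝ φ y w)) (φ y) (fderiv ℝ φ y u)
      + christoffel γ (φ y) (fderiv ℝ (fderiv ℝ φ) y u v) (fderiv ℝ φ y w)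
      + christoffel γ (φ y) (fderiv ℝ φ y v) (fderiv ℝ (fderiv ℝ φ) y u w)) := by
    intro u v w
    have hl := hA1.clm_apply ((hΓ'.clm_apply (hasFDerivAt_const v y)).clm_apply
      (hasFDerivAt_const w y))
    have hr := ((hA2.clm_apply (hasFDerivAt_const v y)).clm_apply (hasFDerivAt_const w y)).add
      (((hΓ.comp y hφ1).clm_apply (hA1.clm_apply (hasFDerivAt_const v y))).clm_apply
        (hA1.clm_apply (hasFDerivAt_const w y)))
    have law' := law v w
    simp only [christoffel_eq] at law'
    have key := congrArg (fun L : E →L[ℝ] F => L u) ((hl.congr_of_eventuallyEq law'.symm).unique hr)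
    rw [fderiv_christoffel hpi hp, fderiv_christoffel hg hγ]
    simp only [christoffel_eq]
    simp at key
    rw [add_comm, key]
    abel
  have s1 : fderiv ℝ (fderiv ℝ (fderiv ℝ φ)) y u v = fderiv ℝ (fderiv ℝ (fderiv ℝ φ)) y v u :=
    (hdφ.isSymmSndFDerivAt (by simp)).eq u v
  have s2 : fderiv ℝ (fderiv ℝ φ) y u v = fderiv ℝ (fderiv ℝ φ) y v u :=
    (hφ2.isSymmSndFDerivAt (by simp)).eq u v
  have pt : ∀ v w, _ := fun v w =>
    fderiv_christoffel_pullForm hφ2 hA (hγ.differentiableAt (by norm_num)) hsymm.self_of_nhds hg v w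
  have d1 := der u v w
  have d2 := der v u w
  rw [← eq_sub_iff_add_eq'] at d1 d2
  simp only [riemann, map_add, map_sub, d1, d2, pt, s1, s2]
  simp only [christoffel_eq, map_add]
  abel

/-- The two curvature endomorphisms are conjugate by the differential of φ, hence have the same
trace. -/
theorem ricci_pullForm {φ : E → F} {γ : F → F →L[ℝ] F →L[ℝ] ℝ} {y : E}
    (hφ : ContDiffAt ℝ 3 φ y) (hA : (fderiv ℝ φ y).IsInvertible)
    (hγ : ContDiffAt ℝ 2 γ (φ y)) (hsymm : ∀ᶠ x in 𝓝 (φ y), ∀ v w, γ x v w = γ x w v)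
    (hg : (γ (φ y)).IsInvertible) (v w : E) :
    ricci (pullForm φ γ) y v w = ricci γ (φ y) (fderiv ℝ φ y v) (fderiv ℝ φ y w) := by
  have hp : ContDiffAt ℝ 2 (pullForm φ γ) y := ContDiffAt.pullForm (by norm_num) hφ hγ
  have hpi : (pullForm φ γ y).IsInvertible := isInvertible_bilinearComp hg hA
  have hR := fun u => fderiv_riemann_pullForm hφ hA hγ hsymm hg u v w
  simp only [riemann_eq hpi hp, riemann_eq hg hγ] at hR
  simp only [ricci, riemann_eq hpi hp, riemann_eq hg hγ]
  obtain ⟨a, ha⟩ := hA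
  rw [← ha] at hR ⊢
  exact ((sum_coord_eq_trace (riemannEndo _ _ v w)).trans
    ((LinearMap.trace_conj' _ a.toLinearEquiv).symm.trans (congrArg _ (LinearMap.ext fun x => by
      rw [LinearEquiv.conj_apply_apply]
      exact (hR _).trans (by
        rw [show (a : E →L[ℝ] F) (a.toLinearEquiv.symm x) = x from a.apply_symm_apply x]
        rfl))))).trans
    (sum_coord_eq_trace (riemannEndo _ _ (a v) (a w))).symm

theorem metricTrace_pullForm (a : E ≃L[ℝ] F) (g : F →L[ℝ] F →L[ℝ] ℝ) (B : F →ₗ[ℝ] F →ₗ[ℝ] ℝ)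
    (hg : g.IsInvertible) :
    metricTrace (g.bilinearComp (a : E →L[ℝ] F) (a : E →L[ℝ] F)) (fun v w => B (a v) (a w)) =
      metricTrace g (fun v w => B v w) := by
  let B' : E →ₗ[ℝ] E →ₗ[ℝ] ℝ := B.compl₁₂ a.toLinearEquiv.toLinearMap a.toLinearEquiv.toLinearMap
  have hi := isInvertible_bilinearComp hg ⟨a, rfl⟩
  rw [show (fun v w => B (a v) (a w)) = fun v w => B' v w from rfl, metricTrace_eq_trace,
    metricTrace_eq_trace, ← LinearMap.trace_conj' (raise _ B') a.toLinearEquiv]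
  congr 1
  ext x
  obtain ⟨v, rfl⟩ := a.surjective x
  have hinj : Function.Injective g := by
    obtain ⟨e, he⟩ := hg
    rw [← he]; exact e.injective
  apply hinj
  ext z'
  obtain ⟨z, rfl⟩ := a.surjective z'
  rw [raise_apply, apply_inverse_apply hg]
  have := apply_inverse_apply hi (LinearMap.toContinuousLinearMap (B' v))
  have := congrArg (fun L : E →L[ℝ] ℝ => L z) this
  simpa [LinearEquiv.conj_apply, raise_apply, B'] using this

/-- The scalar curvature is invariant under changes of coordinates. -/
theorem scalCoord_pullForm {φ : E → F} {γ : F → F →L[ℝ] F →L[ℝ] ℝ} {y : E}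
    (hφ : ContDiffAt ℝ 3 φ y) (hA : (fderiv ℝ φ y).IsInvertible)
    (hγ : ContDiffAt ℝ 2 γ (φ y)) (hsymm : ∀ᶠ x in 𝓝 (φ y), ∀ v w, γ x v w = γ x w v)
    (hg : (γ (φ y)).IsInvertible) :
    scalCoord (pullForm φ γ) y = scalCoord γ (φ y) := by
  have h1 : ricci (pullForm φ γ) y = fun v w => ricci γ (φ y) (fderiv ℝ φ y v) (fderiv ℝ φ y w) :=
    funext fun v => funext fun w => ricci_pullForm hφ hA hγ hsymm hg v w
  obtain ⟨a, ha⟩ := hA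
  rw [scalCoord, scalCoord, h1, pullForm, ← ha,
    show ricci γ (φ y) = _ from funext fun v => funext fun w => ricci_eq hg hγ v w]
  exact metricTrace_pullForm a _ _ hg

theorem scalCoord_congr {γ γ' : E → E →L[ℝ] E →L[ℝ] ℝ} {y : E} (h : γ =ᶠ[𝓝 y] γ') :
    scalCoord γ y = scalCoord γ' y := by
  have h1 : ∀ v w, (fun y' => christoffel γ y' v w) =ᶠ[𝓝 y] fun y' => christoffel γ' y' v w := by
    intro v w
    filter_upwards [h.eventuallyEq_nhds] with y' hy'
    rw [christoffel, christoffel, hy'.fderiv_eq, hy'.eq_of_nhds]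
  have h2 : ricci γ y = ricci γ' y := by
    ext v w
    simp only [ricci, riemann, (h1 _ _).fderiv_eq, (h1 _ _).eq_of_nhds]
  rw [scalCoord, scalCoord, h2, h.eq_of_nhds]

end Invariance

/-! ### Scalar curvature as a function of the second jet of the metric -/

section Jets

variable {E : Type*} [NormedAddCommGroup E] [NormedSpace ℝ E] [FiniteDimensional ℝ E]

/-- The derivative of the Christoffel map in terms of the second jet of the metric. -/
def christoffelDeriv (g : E →L[ℝ] E →L[ℝ] ℝ) (d : E →L[ℝ] E →L[ℝ] E →L[ℝ] ℝ)
    (dd : E →L[ℝ] E →L[ℝ] E →L[ℝ] E →L[ℝ] ℝ) : E →L[ℝ] E →L[ℝ] E →L[ℝ] E :=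
  (fderiv ℝ (fun q : (E →L[ℝ] E →L[ℝ] ℝ) × (E →L[ℝ] E →L[ℝ] E →L[ℝ] ℝ) =>
    christoffelOf q.1 q.2) (g, d)).comp (d.prod dd)

/-- The scalar curvature in terms of the second jet of the metric. -/
def scalJet (g : E →L[ℝ] E →L[ℝ] ℝ) (d : E →L[ℝ] E →L[ℝ] E →L[ℝ] ℝ)
    (dd : E →L[ℝ] E →L[ℝ] E →L[ℝ] E →L[ℝ] ℝ) : ℝ :=
  metricTrace g (fun v w => ricciOf (christoffelOf g d) (christoffelDeriv g d dd) v w)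

theorem scalCoord_eq_scalJet {γ : E → E →L[ℝ] E →L[ℝ] ℝ} {y : E}
    (hg : (γ y).IsInvertible) (hγ : ContDiffAt ℝ 2 γ y) :
    scalCoord γ y = scalJet (γ y) (fderiv ℝ γ y) (fderiv ℝ (fderiv ℝ γ) y) := by
  have h1 : HasFDerivAt γ (fderiv ℝ γ y) y := (hγ.differentiableAt (by norm_num)).hasFDerivAt
  have h2 : HasFDerivAt (fderiv ℝ γ) (fderiv ℝ (fderiv ℝ γ) y) y :=
    ((hγ.fderiv_right (m := 1) (by norm_num)).differentiableAt (by norm_num)).hasFDerivAt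
  have h3 := ((contDiffAt_christoffelOf (n := 1) (p := (γ y, fderiv ℝ γ y)) hg).differentiableAt
    (by norm_num)).hasFDerivAt.comp y (f := fun y' => (γ y', fderiv ℝ γ y')) (h1.prodMk h2)
  have h4 : fderiv ℝ (fun y' => christoffelOf (γ y') (fderiv ℝ γ y')) y =
      christoffelDeriv (γ y) (fderiv ℝ γ y) (fderiv ℝ (fderiv ℝ γ) y) := h3.fderiv
  rw [scalCoord, scalJet, ← h4]
  congr 1
  ext v w
  exact ricci_eq hg hγ v w

/-- Order one suffices: only a Lipschitz bound for the scalar curvature is extracted from it. -/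
theorem contDiffAt_scalJet
    {q : (E →L[ℝ] E →L[ℝ] ℝ) × (E →L[ℝ] E →L[ℝ] E →L[ℝ] ℝ) ×
      (E →L[ℝ] E →L[ℝ] E →L[ℝ] E →L[ℝ] ℝ)} (hq : q.1.IsInvertible) :
    ContDiffAt ℝ 1 (fun q : (E →L[ℝ] E →L[ℝ] ℝ) × (E →L[ℝ] E →L[ℝ] E →L[ℝ] ℝ) ×
      (E →L[ℝ] E →L[ℝ] E →L[ℝ] E →L[ℝ] ℝ) => scalJet q.1 q.2.1 q.2.2) q := by
  have h0 : ContDiffAt ℝ 1 (fun q : (E →L[ℝ] E →L[ℝ] ℝ) × (E →L[ℝ] E →L[ℝ] E →L[ℝ] ℝ) ×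
      (E →L[ℝ] E →L[ℝ] E →L[ℝ] E →L[ℝ] ℝ) => q.1.inverse) q :=
    (hq.contDiffAt_map_inverse (n := 1)).comp q contDiffAt_fst
  have hp : ContDiffAt ℝ 1 (fun q : (E →L[ℝ] E →L[ℝ] ℝ) × (E →L[ℝ] E →L[ℝ] E →L[ℝ] ℝ) ×
      (E →L[ℝ] E →L[ℝ] E →L[ℝ] E →L[ℝ] ℝ) => (q.1, q.2.1)) q := by fun_prop
  have hΓ : ContDiffAt ℝ 1 (fun q : (E →L[ℝ] E →L[ℝ] ℝ) × (E →L[ℝ] E →L[ℝ] E →L[ℝ] ℝ) ×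
      (E →L[ℝ] E →L[ℝ] E →L[ℝ] E →L[ℝ] ℝ) => christoffelOf q.1 q.2.1) q :=
    ContDiffAt.comp (g := fun r : (E →L[ℝ] E →L[ℝ] ℝ) × (E →L[ℝ] E →L[ℝ] E →L[ℝ] ℝ) =>
      christoffelOf r.1 r.2) q (contDiffAt_christoffelOf (n := 1) (p := (q.1, q.2.1)) hq) hp
  have hD : ContDiffAt ℝ 1 (fun q : (E →L[ℝ] E →L[ℝ] ℝ) × (E →L[ℝ] E →L[ℝ] E →L[ℝ] ℝ) ×
      (E →L[ℝ] E →L[ℝ] E →L[ℝ] E →L[ℝ] ℝ) => christoffelDeriv q.1 q.2.1 q.2.2) q := by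
    have h2 := (contDiffAt_christoffelOf (n := 2) (p := (q.1, q.2.1)) hq).fderiv_right
      (m := 1) (by norm_num)
    have hP : ContDiff ℝ 1 (fun r : (E →L[ℝ] E →L[ℝ] E →L[ℝ] ℝ) ×
        (E →L[ℝ] E →L[ℝ] E →L[ℝ] E →L[ℝ] ℝ) => r.1.prod r.2) := by
      have h := ((contDiff_const (c := ContinuousLinearMap.inl ℝ (E →L[ℝ] E →L[ℝ] ℝ)
        (E →L[ℝ] E →L[ℝ] E →L[ℝ] ℝ))).clm_comp contDiff_fst).add
        ((contDiff_const (c := ContinuousLinearMap.inr ℝ (E →L[ℝ] E →L[ℝ] ℝ)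
        (E →L[ℝ] E →L[ℝ] E →L[ℝ] ℝ))).clm_comp contDiff_snd) (𝕜 := ℝ) (n := 1)
        (E := (E →L[ℝ] E →L[ℝ] E →L[ℝ] ℝ) × (E →L[ℝ] E →L[ℝ] E →L[ℝ] E →L[ℝ] ℝ))
      convert h using 2
      ext u <;> simp
    have h3 := hP.contDiffAt.comp q (contDiffAt_snd (n := 1) (𝕜 := ℝ) (p := q))
    exact (h2.comp q hp).clm_comp h3
  have hc : ∀ i, ContDiff ℝ 1 ((Module.finBasis ℝ E).coord i) := fun i =>
    (LinearMap.toContinuousLinearMap ((Module.finBasis ℝ E).coord i)).contDiff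
  have hev : ∀ u v w, ContDiffAt ℝ 1 (fun q : (E →L[ℝ] E →L[ℝ] ℝ) ×
      (E →L[ℝ] E →L[ℝ] E →L[ℝ] ℝ) × (E →L[ℝ] E →L[ℝ] E →L[ℝ] E →L[ℝ] ℝ) =>
      riemannOf (christoffelOf q.1 q.2.1) (christoffelDeriv q.1 q.2.1 q.2.2) u v w) q := by
    intro u v w
    have c : ∀ x : E, ContDiffAt ℝ 1 (fun _ : (E →L[ℝ] E →L[ℝ] ℝ) ×
      (E →L[ℝ] E →L[ℝ] E →L[ℝ] ℝ) × (E →L[ℝ] E →L[ℝ] E →L[ℝ] E →L[ℝ] ℝ) => x) q :=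
      fun x => contDiffAt_const
    have hΓ2 := fun x y => (hΓ.clm_apply (c x)).clm_apply (c y)
    exact (((((hD.clm_apply (c u)).clm_apply (c v)).clm_apply (c w)).sub
      (((hD.clm_apply (c v)).clm_apply (c u)).clm_apply (c w))).add
      ((hΓ.clm_apply (c u)).clm_apply (hΓ2 v w))).sub
      ((hΓ.clm_apply (c v)).clm_apply (hΓ2 u w))
  simp only [scalJet, metricTrace, ricciOf, LinearMap.mk₂_apply]
  refine ContDiffAt.sum fun i _ => ContDiffAt.sum fun j _ => ContDiffAt.mul ?_ ?_
  · exact (hc i).contDiffAt.comp q (h0.clm_apply contDiffAt_const)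
  · exact ContDiffAt.sum fun l _ => (hc l).contDiffAt.comp q (hev _ _ _)

/-- For a fixed metric the Christoffel map is linear in the first derivative `d`, so it is its own
derivative in that variable; this is why second derivatives enter curvature affinely. -/
theorem christoffelDeriv_add (g : E →L[ℝ] E →L[ℝ] ℝ) (hg : g.IsInvertible)
    (d : E →L[ℝ] E →L[ℝ] E →L[ℝ] ℝ) (dd e : E →L[ℝ] E →L[ℝ] E →L[ℝ] E →L[ℝ] ℝ) (u : E) :
    christoffelDeriv g d (dd + e) u = christoffelDeriv g d dd u + christoffelOf g (e u) := by
  let N : (E →L[ℝ] E →L[ℝ] E →L[ℝ] ℝ) →L[ℝ] (E →L[ℝ] E →L[ℝ] E) :=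
    (ContinuousLinearMap.compL ℝ E (E →L[ℝ] E →L[ℝ] ℝ) (E →L[ℝ] E)
      (ContinuousLinearMap.compL ℝ E (E →L[ℝ] ℝ) E g.inverse)).comp lowerChristoffel
  have h1 := ((contDiffAt_christoffelOf (n := 1) (p := (g, d)) hg).differentiableAt
    (by norm_num)).hasFDerivAt.comp d (f := fun d => (g, d))
    ((hasFDerivAt_const g d).prodMk (hasFDerivAt_id d))
  have h2 : HasFDerivAt (fun d => christoffelOf g d) N d := N.hasFDerivAt
  have h3 := congrArg (fun L : _ →L[ℝ] (E →L[ℝ] E →L[ℝ] E) => L (e u)) (h1.unique h2)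
  have h4 : christoffelOf g (e u) = N (e u) := rfl
  rw [h4, ← h3]
  simp only [christoffelDeriv, ContinuousLinearMap.comp_apply, ContinuousLinearMap.prod_apply,
    add_apply, zero_apply, ContinuousLinearMap.id_apply]
  rw [← map_add]
  simp

/-- The effect on the scalar curvature of a change `c τ ⊗ τ ⊗ β` of the second derivative of the
metric, where `τ` is the covector dual to a unit vector `e` and `β` vanishes on `e`. -/
theorem scalJet_add {g : E →L[ℝ] E →L[ℝ] ℝ} (hg : g.IsInvertible)
    (hsymm : ∀ v w, g v w = g w v) (d : E →L[ℝ] E →L[ℝ] E →L[ℝ] ℝ)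
    (dd ee : E →L[ℝ] E →L[ℝ] E →L[ℝ] E →L[ℝ] ℝ) (c : ℝ) (τ : E →L[ℝ] ℝ) (β : E →L[ℝ] E →L[ℝ] ℝ)
    (e : E) (he : g e = τ) (hτ : τ e = 1) (hβ : ∀ v, β v e = 0) (hβ' : ∀ v, β e v = 0)
    (hee : ∀ u v, ee u v = (c * (τ u * τ v)) • β) :
    scalJet g d (dd + ee) = scalJet g d dd - c * metricTrace g (fun v w => β v w) := by
  have hτe : g.inverse τ = e := by rw [← he, inverse_apply_apply hg]
  have hτβ : ∀ v, τ (g.inverse (β v)) = 0 := fun v => by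
    rw [← he, hsymm, apply_inverse_apply hg, hβ]
  let b : E →ₗ[ℝ] E →ₗ[ℝ] ℝ := β.toLinearMap₁₂
  let tt : E →ₗ[ℝ] E →ₗ[ℝ] ℝ := (τ.smulRight τ).toLinearMap₁₂
  set tr := metricTrace g (fun v w => β v w) with htr
  have htr' : tr = LinearMap.trace ℝ E (raise g b) := metricTrace_eq_trace g b
  have hbr : ∀ v, raise g b v = g.inverse (β v) := fun v => rfl
  have h1 : LinearMap.trace ℝ E (raise g tt) = 1 := by
    have : raise g tt = (τ : E →ₗ[ℝ] ℝ).smulRight e := by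
      ext v
      have : raise g tt v = g.inverse (τ v • τ) := rfl
      rw [this, map_smul, hτe]; rfl
    rw [this, LinearMap.trace_smulRight]; exact hτ
  have hric : ricciOf (christoffelOf g d) (christoffelDeriv g d (dd + ee)) =
      ricciOf (christoffelOf g d) (christoffelDeriv g d dd) - (c / 2) • b - (c / 2 * tr) • tt := by
    ext v w
    -- Apart from the multiple of `raise g b`, whose trace is `tr`, the correction consists of
    -- rank-one maps. Hence the Ricci form changes by -(c/2) β - (c/2) tr(β) τ ⊗ τ, and the two
    -- terms contribute equally to the scalar curvature.
    have hE : riemannEndo (christoffelOf g d) (christoffelDeriv g d (dd + ee)) v w =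
        riemannEndo (christoffelOf g d) (christoffelDeriv g d dd) v w
        + (c / 2) • ((τ : E →ₗ[ℝ] ℝ).smulRight (τ w • g.inverse (β v) - β v w • e)
          - (τ v * τ w) • raise g b + τ v • ((β.flip w : E →L[ℝ] ℝ) : E →ₗ[ℝ] ℝ).smulRight e) := by
      ext u
      have hl : ∀ u v w, lowerChristoffel (ee u) v w =
          (c / 2 * τ u) • (τ v • β w + τ w • β v - β v w • τ) := by
        intro u v w
        ext z
        simp only [lowerChristoffel_apply, hee, smul_apply, smul_eq_mul, add_apply, sub_apply]
        ring
      have hR : riemannEndo (christoffelOf g d) (christoffelDeriv g d (dd + ee)) v w u =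
        riemannEndo (christoffelOf g d) (christoffelDeriv g d dd) v w u
        + (christoffelOf g (ee u) v w - christoffelOf g (ee v) u w) := by
        simp only [riemannEndo, riemannOf, LinearMap.coe_mk, AddHom.coe_mk,
          christoffelDeriv_add g hg, add_apply]
        abel
      rw [hR, christoffelOf_apply, christoffelOf_apply, hl, hl]
      simp only [LinearMap.add_apply, LinearMap.smul_apply, LinearMap.sub_apply,
        LinearMap.smulRight_apply, hbr, map_smul, map_add, map_sub, hτe,
        ContinuousLinearMap.coe_coe, ContinuousLinearMap.flip_apply]
      module
    rw [ricciOf_eq_trace, hE, map_add, map_smul, map_add, map_sub, map_smul, map_smul, ← htr',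
      LinearMap.trace_smulRight, LinearMap.trace_smulRight, ← ricciOf_eq_trace]
    have e1 : τ (g.inverse (β v)) = 0 := hτβ v
    simp only [LinearMap.sub_apply, LinearMap.smul_apply, ContinuousLinearMap.coe_coe, map_sub,
      map_smul, e1, hτ, ContinuousLinearMap.flip_apply, hβ', smul_eq_mul]
    have e2 : b v w = β v w := rfl
    have e3 : tt v w = τ v * τ w := rfl
    rw [e2, e3]
    ring
  rw [scalJet, scalJet, hric, metricTrace_eq_trace, metricTrace_eq_trace]
  have hlin : raise g (ricciOf (christoffelOf g d) (christoffelDeriv g d dd) - (c / 2) • b -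
      (c / 2 * tr) • tt) = raise g (ricciOf (christoffelOf g d) (christoffelDeriv g d dd))
      - (c / 2) • raise g b - (c / 2 * tr) • raise g tt := by
    simp only [raise, LinearMap.comp_sub, LinearMap.comp_smul]
  rw [hlin, map_sub, map_sub, map_smul, map_smul, h1, ← htr']
  simp only [smul_eq_mul]; ring

end Jets

/-! ### The scalar curvature of dt² + g_{h(t)} -/

section Warp

variable {E : Type*} [NormedAddCommGroup E] [NormedSpace ℝ E]

/-- The linear map `(b, v) ↦ (a b, v)`. -/
def stretch (a : ℝ) : ℝ × E →L[ℝ] ℝ × E :=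
  (a • ContinuousLinearMap.fst ℝ ℝ E).prod (ContinuousLinearMap.snd ℝ ℝ E)

theorem stretch_apply (a : ℝ) (v : ℝ × E) : stretch a v = (a * v.1, v.2) := rfl

theorem stretch_one : stretch (E := E) 1 = ContinuousLinearMap.id ℝ (ℝ × E) := by
  ext v <;> simp [stretch_apply]

/-- The first factor, as a linear map into the product. -/
def firstPart : ℝ × E →L[ℝ] ℝ × E :=
  (ContinuousLinearMap.fst ℝ ℝ E).prod (0 : ℝ × E →L[ℝ] E)

theorem firstPart_apply (v : ℝ × E) : firstPart v = (v.1, 0) := rfl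

theorem stretch_eq (a : ℝ) : stretch (E := E) a = stretch 0 + a • firstPart := by
  ext v <;> simp [stretch_apply, firstPart_apply]

theorem contDiff_stretch {n : ℕ∞ω} : ContDiff ℝ n (stretch (E := E)) := by
  rw [show stretch (E := E) = fun a => stretch 0 + a • firstPart from funext stretch_eq]
  exact contDiff_const.add (contDiff_id.smul contDiff_const)

theorem hasFDerivAt_warp {h : ℝ → ℝ} {z : ℝ × E} (hh : DifferentiableAt ℝ h z.1) :
    HasFDerivAt (fun z : ℝ × E => (h z.1, z.2)) (stretch (deriv h z.1)) z := by
  have h1 : HasFDerivAt (fun z : ℝ × E => h z.1)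
      (deriv h z.1 • ContinuousLinearMap.fst ℝ ℝ E) z :=
    hh.hasDerivAt.comp_hasFDerivAt z (hasFDerivAt_fst (p := z))
  exact h1.prodMk (hasFDerivAt_snd (p := z))

variable {V : Type*} [NormedAddCommGroup V] [NormedSpace ℝ V]

theorem fderiv_warp {h : ℝ → ℝ} {z : ℝ × E} {G : ℝ × E → V}
    (hh : DifferentiableAt ℝ h z.1) (hG : DifferentiableAt ℝ G (h z.1, z.2)) :
    fderiv ℝ (fun z : ℝ × E => G (h z.1, z.2)) z =
      (fderiv ℝ G (h z.1, z.2)).comp (stretch (deriv h z.1)) :=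
  (hG.hasFDerivAt.comp z (hasFDerivAt_warp hh)).fderiv

/-- The extra summand with h'' comes from differentiating the factor `stretch (deriv h z.1)` of the
first derivative. -/
theorem fderiv_fderiv_warp {h : ℝ → ℝ} {z : ℝ × E} {G : ℝ × E → V}
    (hh : ContDiffAt ℝ 2 h z.1) (hG : ContDiffAt ℝ 2 G (h z.1, z.2)) (u v : ℝ × E) :
    fderiv ℝ (fderiv ℝ (fun z : ℝ × E => G (h z.1, z.2))) z u v =
      (fderiv ℝ (fderiv ℝ G) (h z.1, z.2)).bilinearComp (stretch (deriv h z.1))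
        (stretch (deriv h z.1)) u v +
      (deriv (deriv h) z.1 * (u.1 * v.1)) • fderiv ℝ G (h z.1, z.2) (1, 0) := by
  have hc : ContinuousAt (fun z : ℝ × E => (h z.1, z.2)) z :=
    (hasFDerivAt_warp (hh.differentiableAt (by norm_num))).continuousAt
  have e1 : ∀ᶠ z' in 𝓝 z, DifferentiableAt ℝ h (z' : ℝ × E).1 :=
    continuousAt_fst ((hh.eventually (by simp)).mono fun x hx => hx.differentiableAt (by norm_num))
  have e2 : ∀ᶠ z' in 𝓝 z, DifferentiableAt ℝ G (h (z' : ℝ × E).1, z'.2) :=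
    hc ((hG.eventually (by simp)).mono fun x hx => hx.differentiableAt (by norm_num))
  have e3 : fderiv ℝ (fun z : ℝ × E => G (h z.1, z.2)) =ᶠ[𝓝 z] fun z =>
      (fderiv ℝ G (h z.1, z.2)).comp (stretch (deriv h z.1)) := by
    filter_upwards [e1, e2] with z' h1 h2 using fderiv_warp h1 h2
  have hd : HasDerivAt (deriv h) (deriv (deriv h) z.1) z.1 := by
    have : ContDiffAt ℝ 1 (deriv h) z.1 := hh.derivWithin (by norm_num)
    exact (this.differentiableAt (by norm_num)).hasDerivAt
  have h1 : HasFDerivAt (fun z : ℝ × E => stretch (E := E) (deriv h z.1))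
      ((deriv (deriv h) z.1 • ContinuousLinearMap.fst ℝ ℝ E).smulRight firstPart) z := by
    rw [show (fun z : ℝ × E => stretch (E := E) (deriv h z.1)) =
      fun z => stretch 0 + deriv h z.1 • firstPart from funext fun z => stretch_eq _]
    exact ((hd.comp_hasFDerivAt z (hasFDerivAt_fst (𝕜 := ℝ) (F := E) (p := z))).smul_const
      (firstPart (E := E))).const_add _
  have h2 := (((hG.fderiv_right (m := 1) (by norm_num)).differentiableAt
    (by norm_num)).hasFDerivAt).comp z (hasFDerivAt_warp (hh.differentiableAt (by norm_num)))
  have h3 := (h2.clm_comp h1).fderiv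
  simp only [Function.comp_def] at h3
  rw [e3.fderiv_eq, h3]
  simp only [add_apply, ContinuousLinearMap.comp_apply, ContinuousLinearMap.compL_apply,
    ContinuousLinearMap.flip_apply, ContinuousLinearMap.smulRight_apply, smul_apply,
    ContinuousLinearMap.coe_fst', ContinuousLinearMap.bilinearComp_apply, smul_eq_mul]
  rw [add_comm]
  congr 1
  rw [show (firstPart v : ℝ × E) = v.1 • ((1 : ℝ), (0 : E)) by simp [firstPart_apply]]
  simp only [map_smul, smul_smul]
  ring_nf

variable [FiniteDimensional ℝ E]

/-- The scalar curvature of `G (s + a τ, y)` at `τ = 0`. -/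
def scalWarp (G : ℝ × E → ℝ × E →L[ℝ] ℝ × E →L[ℝ] ℝ) (q : (ℝ × E) × ℝ) : ℝ :=
  scalJet (G q.1) ((fderiv ℝ G q.1).comp (stretch q.2))
    ((fderiv ℝ (fderiv ℝ G) q.1).bilinearComp (stretch q.2) (stretch q.2))

theorem contDiffAt_scalWarp {G : ℝ × E → ℝ × E →L[ℝ] ℝ × E →L[ℝ] ℝ} {q : (ℝ × E) × ℝ}
    (hi : (G q.1).IsInvertible) (hG : ContDiffAt ℝ ∞ G q.1) : ContDiffAt ℝ 1 (scalWarp G) q := by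
  have h0 : ContDiffAt ℝ 1 (fun q : (ℝ × E) × ℝ => G q.1) q :=
    (hG.of_le ENat.LEInfty.out).comp q contDiffAt_fst
  have hs : ContDiffAt ℝ 1 (fun q : (ℝ × E) × ℝ => stretch (E := E) q.2) q :=
    (contDiff_stretch (E := E)).contDiffAt.comp q contDiffAt_snd
  have hd : ContDiffAt ℝ 2 (fderiv ℝ G) q.1 := hG.fderiv_right (m := 2) (by norm_num; exact ENat.LEInfty.out)
  have h1 : ContDiffAt ℝ 1 (fun q : (ℝ × E) × ℝ => fderiv ℝ G q.1) q :=
    (hd.of_le (by norm_num)).comp q contDiffAt_fst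
  have h2 : ContDiffAt ℝ 1 (fun q : (ℝ × E) × ℝ => fderiv ℝ (fderiv ℝ G) q.1) q :=
    (hd.fderiv_right (m := 1) (by norm_num)).comp q contDiffAt_fst
  have h3 : ContDiffAt ℝ 1 (fun q : (ℝ × E) × ℝ => (fderiv ℝ G q.1).comp (stretch q.2)) q :=
    h1.clm_comp hs
  have h4 : ContDiffAt ℝ 1 (fun q : (ℝ × E) × ℝ =>
      (fderiv ℝ (fderiv ℝ G) q.1).bilinearComp (stretch q.2) (stretch q.2)) q :=
    contDiffAt_bilinearComp h2 hs
  have hJ := contDiffAt_scalJet (q := (G q.1, (fderiv ℝ G q.1).comp (stretch q.2),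
    (fderiv ℝ (fderiv ℝ G) q.1).bilinearComp (stretch q.2) (stretch q.2))) hi
  have h5 := hJ.comp (f := fun q : (ℝ × E) × ℝ => (G q.1, (fderiv ℝ G q.1).comp (stretch q.2),
    (fderiv ℝ (fderiv ℝ G) q.1).bilinearComp (stretch q.2) (stretch q.2))) q
    (h0.prodMk (h3.prodMk h4))
  exact h5

theorem scalWarp_one {G : ℝ × E → ℝ × E →L[ℝ] ℝ × E →L[ℝ] ℝ} {z : ℝ × E}
    (hi : (G z).IsInvertible) (hG : ContDiffAt ℝ 2 G z) : scalWarp G (z, 1) = scalCoord G z := by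
  rw [scalCoord_eq_scalJet hi hG, scalWarp, stretch_one]
  rfl

/-- `G` is at `z` a scalar product of the form `dt² + g_t`. -/
def IsFermiForm (G : ℝ × E → ℝ × E →L[ℝ] ℝ × E →L[ℝ] ℝ) (z : ℝ × E) : Prop :=
  (∀ v w, G z v w = G z w v) ∧ (∀ v, v ≠ 0 → 0 < G z v v) ∧ ∀ v, G z (1, 0) v = v.1

-- A positive form is injective into the dual, which has the same dimension.
omit [NormedAddCommGroup V] [NormedSpace ℝ V] in
theorem isInvertible_of_pos {F : Type*} [NormedAddCommGroup F] [NormedSpace ℝ F]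
    [FiniteDimensional ℝ F] {g : F →L[ℝ] F →L[ℝ] ℝ} (hg : ∀ v, v ≠ 0 → 0 < g v v) :
    g.IsInvertible := by
  have hinj : Function.Injective (g : F →ₗ[ℝ] F →L[ℝ] ℝ) := by
    rw [← LinearMap.ker_eq_bot, LinearMap.ker_eq_bot']
    intro v hv
    by_contra hne
    have := hg v hne
    rw [show g v = 0 from hv] at this
    simp at this
  have hdim : Module.finrank ℝ F = Module.finrank ℝ (F →L[ℝ] ℝ) := by
    rw [← (LinearMap.toContinuousLinearMap (𝕜 := ℝ) (E := F) (F' := ℝ)).finrank_eq]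
    exact (Subspace.dual_finrank_eq (K := ℝ) (V := F)).symm
  refine ⟨(LinearEquiv.ofInjectiveOfFinrankEq (g : F →ₗ[ℝ] F →L[ℝ] ℝ) hinj
    hdim).toContinuousLinearEquiv, ?_⟩
  ext v w
  rfl

/-- The entries G(∂_t, v) are locally constant. This supplies the condition of `scalJet_add` that β
= ∂_t G annihilates ∂_t. -/
theorem IsFermiForm.fderiv_eq_zero {G : ℝ × E → ℝ × E →L[ℝ] ℝ × E →L[ℝ] ℝ} {z : ℝ × E}
    (hF : ∀ᶠ z' in 𝓝 z, IsFermiForm G z') (hG : DifferentiableAt ℝ G z) (u v : ℝ × E) :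
    fderiv ℝ G z u (1, 0) v = 0 ∧ fderiv ℝ G z u v (1, 0) = 0 := by
  have key : ∀ (a b : ℝ × E) (c : ℝ), (fun z => G z a b) =ᶠ[𝓝 z] (fun _ => c) →
      fderiv ℝ G z u a b = 0 := by
    intro a b c h
    have ha := (hG.hasFDerivAt.clm_apply (hasFDerivAt_const a _)).clm_apply (hasFDerivAt_const b _)
    have := congrArg (fun L : ℝ × E →L[ℝ] ℝ => L u)
      (ha.unique ((hasFDerivAt_const c z).congr_of_eventuallyEq h))
    simpa using this
  exact ⟨key _ _ v.1 (hF.mono fun z' hz' => hz'.2.2 v),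
    key _ _ v.1 (hF.mono fun z' hz' => (hz'.1 _ _).trans (hz'.2.2 v))⟩

/-- The scalar curvature of `dt² + g_{h(t)}`. -/
theorem scalCoord_warp {G : ℝ × E → ℝ × E →L[ℝ] ℝ × E →L[ℝ] ℝ} {h : ℝ → ℝ} {z : ℝ × E}
    (hh : ContDiffAt ℝ 2 h z.1) (hG : ContDiffAt ℝ 2 G (h z.1, z.2))
    (hF : ∀ᶠ z' in 𝓝 (h z.1, z.2), IsFermiForm G z') :
    scalCoord (fun z : ℝ × E => G (h z.1, z.2)) z =
      scalWarp G ((h z.1, z.2), deriv h z.1) - deriv (deriv h) z.1 *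
        metricTrace (G (h z.1, z.2)) (fun v w => fderiv ℝ G (h z.1, z.2) (1, 0) v w) := by
  obtain ⟨hs, hp, h1⟩ := hF.self_of_nhds
  have hi := isInvertible_of_pos hp
  have hdG := (hG.differentiableAt (by norm_num)).hasFDerivAt
  have hw : ContDiffAt ℝ 2 (fun z : ℝ × E => (h z.1, z.2)) z :=
    (hh.comp z contDiffAt_fst).prodMk contDiffAt_snd
  have hGw : ContDiffAt ℝ 2 (fun z : ℝ × E => G (h z.1, z.2)) z := hG.comp z hw
  have hβ := IsFermiForm.fderiv_eq_zero hF hdG.differentiableAt (1, 0)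
  have e1 := fderiv_fderiv_warp hh hG
  -- The part h'' dt ⊗ dt ⊗ ∂_t G of the second derivative; the remainder of the jet is exactly the
  -- one in `scalWarp`.
  let ee : ℝ × E →L[ℝ] ℝ × E →L[ℝ] ℝ × E →L[ℝ] ℝ × E →L[ℝ] ℝ :=
    deriv (deriv h) z.1 • (ContinuousLinearMap.fst ℝ ℝ E).smulRight
      ((ContinuousLinearMap.fst ℝ ℝ E).smulRight (fderiv ℝ G (h z.1, z.2) (1, 0)))
  have hee : ∀ u v, ee u v = (deriv (deriv h) z.1 *
      (ContinuousLinearMap.fst ℝ ℝ E u * ContinuousLinearMap.fst ℝ ℝ E v)) •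
        fderiv ℝ G (h z.1, z.2) (1, 0) := by
    intro u v
    simp only [ee, smul_apply, ContinuousLinearMap.smulRight_apply]
    module
  have e2 : fderiv ℝ (fderiv ℝ (fun z : ℝ × E => G (h z.1, z.2))) z =
      (fderiv ℝ (fderiv ℝ G) (h z.1, z.2)).bilinearComp (stretch (deriv h z.1))
        (stretch (deriv h z.1)) + ee := by
    refine ContinuousLinearMap.ext fun u => ContinuousLinearMap.ext fun v => ?_
    rw [e1, add_apply, add_apply, hee]
    rfl
  rw [scalCoord_eq_scalJet (γ := fun z : ℝ × E => G (h z.1, z.2)) hi hGw, e2, fderiv_warp (hh.differentiableAt (by norm_num))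
    hdG.differentiableAt]
  exact scalJet_add hi hs _ _ ee _ (ContinuousLinearMap.fst ℝ ℝ E) _ (1, 0)
    (ContinuousLinearMap.ext h1) rfl (fun v => (hβ v).2) (fun v => (hβ v).1) hee

end Warp

/-! ### Consequences of convexity and growth for compressions -/

section Compression

theorem IsCompression.deriv_odd {k δ : ℝ} {h : ℝ → ℝ} (H : IsCompression k δ h) :
    deriv h 0 = 0 := by
  have h1 := deriv_comp_neg h 0
  rw [show (fun t => h (-t)) = h from funext H.even, neg_zero] at h1
  linarith

/-- Since h' increases from h'(0) = 0 and h(δ) = δ, the mean value inequality on [t, δ] gives h'(t)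
(δ - t) ≤ δ - h(t) ≤ δ - t. The left half rearranges to h(t) - t ≤ (δ - t)(1 - h'(t)), so 1 - h'
controls both the displacement and the change of slope. -/
theorem IsCompression.estimates {k δ : ℝ} {h : ℝ → ℝ} (H : IsCompression k δ h) {t : ℝ}
    (ht : t ∈ Set.Icc 0 δ) :
    0 ≤ deriv h t ∧ deriv h t ≤ 1 ∧ t ≤ h t ∧ h t ≤ δ ∧ h t - t ≤ δ * (1 - deriv h t) ∧
      k * (1 - deriv h t) ≤ deriv (deriv h) t := by
  have hd : Differentiable ℝ h := H.smooth.differentiable (by simp)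
  have hd2 : Differentiable ℝ (deriv h) :=
    ((contDiff_infty_iff_deriv.1 H.smooth).2).differentiable (by simp)
  have hmono : Monotone (deriv h) := monotone_of_deriv_nonneg hd2 H.convex
  have h0 : 0 ≤ deriv h t := by
    rw [← H.deriv_odd]; exact hmono ht.1
  have h1 : deriv h t ≤ 1 := (abs_le.1 (H.abs_deriv_le t)).2
  have hδ : h δ = δ := H.right δ le_rfl
  have hup : h δ - h t ≤ 1 * (δ - t) :=
    Convex.image_sub_le_mul_sub_of_deriv_le convex_univ hd.continuous.continuousOn
      (hd.differentiableOn) (fun x _ => (abs_le.1 (H.abs_deriv_le x)).2) t trivial δ trivial ht.2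
  have hlow : deriv h t * (δ - t) ≤ h δ - h t :=
    Convex.mul_sub_le_image_sub_of_le_deriv (convex_Icc t δ) hd.continuous.continuousOn
      hd.differentiableOn (fun x hx => hmono (by rw [interior_Icc] at hx; exact hx.1.le))
      t ⟨le_rfl, ht.2⟩ δ ⟨ht.2, le_rfl⟩ ht.2
  have hg := H.growth_right t ht.1
  rw [abs_of_nonneg (H.convex t), abs_sub_comm, abs_of_nonneg (by linarith)] at hg
  have ht1 := ht.1
  have ht2 := ht.2
  refine ⟨h0, h1, by linarith, ?_, ?_, hg⟩
  · have : 0 ≤ deriv h t * (δ - t) := mul_nonneg h0 (by linarith)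
    linarith
  · have : 0 ≤ t * (1 - deriv h t) := mul_nonneg ht.1 (by linarith)
    nlinarith

end Compression

/-! ### The local scalar curvature estimate -/

section Local

variable {E : Type*} [NormedAddCommGroup E] [NormedSpace ℝ E] [FiniteDimensional ℝ E]

/-- Near a point of positive mean curvature, compressing a metric `dt² + g_t` does not decrease
the scalar curvature. -/
theorem exists_scalCoord_le_warp {G : ℝ × E → ℝ × E →L[ℝ] ℝ × E →L[ℝ] ℝ} {σ : ℝ} (hσ : 0 < σ)
    {V : Set E} (hV : IsOpen V) {y₀ : E} (hy₀ : y₀ ∈ V)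
    (hG : ∀ z ∈ Set.Ioo (-σ) σ ×ˢ V, ContDiffAt ℝ ∞ G z)
    (hF : ∀ z ∈ Set.Ioo (-σ) σ ×ˢ V, IsFermiForm G z)
    (hmean : metricTrace (G (0, y₀)) (fun v w => fderiv ℝ G (0, y₀) (1, 0) v w) < 0) :
    ∃ N ∈ 𝓝 y₀, N ⊆ V ∧ ∃ σ₁ : ℝ, 0 < σ₁ ∧ σ₁ < σ ∧ ∃ k₀ : ℝ, ∀ k δ : ℝ, k₀ ≤ k → δ ≤ σ₁ →
      ∀ h : ℝ → ℝ, IsCompression k δ h → ∀ t ∈ Set.Icc 0 δ, ∀ y ∈ N,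
        scalCoord G (t, y) ≤ scalCoord (fun z : ℝ × E => G (h z.1, z.2)) (t, y) := by
  have hopen : IsOpen (Set.Ioo (-σ) σ ×ˢ V) := isOpen_Ioo.prod hV
  have hmem : ((0 : ℝ), y₀) ∈ Set.Ioo (-σ) σ ×ˢ V := ⟨⟨by linarith, hσ⟩, hy₀⟩
  set T : ℝ × E → ℝ := fun z => metricTrace (G z) (fun v w => fderiv ℝ G z (1, 0) v w) with hT
  have hTc : ContinuousAt T (0, y₀) := by
    have hi := isInvertible_of_pos (hF _ hmem).2.1
    have hGc := (hG _ hmem).continuousAt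
    have hinv : ContinuousAt (fun z => (G z).inverse) (0, y₀) :=
      ContinuousAt.comp (g := ContinuousLinearMap.inverse)
        (hi.contDiffAt_map_inverse (n := 0)).continuousAt hGc
    have hd : ContinuousAt (fderiv ℝ G) (0, y₀) :=
      ((hG _ hmem).fderiv_right (m := 0) (by simp)).continuousAt
    simp only [hT, metricTrace]
    refine tendsto_finsetSum _ fun i _ => tendsto_finsetSum _ fun j _ => Filter.Tendsto.mul ?_ ?_
    · exact ((LinearMap.continuous_of_finiteDimensional _).continuousAt).comp
        (hinv.clm_apply continuousAt_const)
    · exact ((hd.clm_apply continuousAt_const).clm_apply continuousAt_const).clm_apply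
        continuousAt_const
  -- Half of the available negativity, so that `T < -c` persists near `(0, y₀)`.
  set c : ℝ := -T (0, y₀) / 2 with hc
  have hc0 : 0 < c := by
    have : T (0, y₀) < 0 := hmean
    linarith
  have hev : ∀ᶠ z in 𝓝 ((0 : ℝ), y₀), z ∈ Set.Ioo (-σ) σ ×ˢ V ∧ T z < -c :=
    (hopen.eventually_mem hmem).and (hTc.eventually_lt continuousAt_const (by simp only [hc]; linarith))
  obtain ⟨ε, hε, hball⟩ := Metric.eventually_nhds_iff_ball.1 hev
  -- The bound by 1 forces δ ≤ 1, so that h(t) - t is at most 1 - h'(t); the bound by ε/2 keeps the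
  -- closed box inside the ball of radius ε.
  set r : ℝ := min (ε / 2) 1 with hr
  have hr0 : 0 < r := lt_min (by linarith) one_pos
  have hrε : r < ε := (min_le_left _ _).trans_lt (by linarith)
  have hr1 : r ≤ 1 := min_le_right _ _
  have hin : ∀ s ∈ Set.Icc 0 r, ∀ y ∈ Metric.closedBall y₀ r,
      (s, y) ∈ Set.Ioo (-σ) σ ×ˢ V ∧ T (s, y) < -c := by
    intro s hs y hy
    refine hball _ ?_
    rw [Metric.mem_ball, Prod.dist_eq, max_lt_iff]
    refine ⟨?_, (Metric.mem_closedBall.1 hy).trans_lt hrε⟩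
    rw [Real.dist_eq, sub_zero, abs_of_nonneg hs.1]
    exact hs.2.trans_lt hrε
  -- A compact convex set containing both ((t, y), 1) and ((h t, y), h' t); on it a C¹ function is
  -- Lipschitz.
  set K : Set ((ℝ × E) × ℝ) := (Set.Icc 0 r ×ˢ Metric.closedBall y₀ r) ×ˢ Set.Icc 0 1 with hK
  have hKconv : Convex ℝ K := ((convex_Icc 0 r).prod (convex_closedBall y₀ r)).prod (convex_Icc 0 1)
  have hKcomp : IsCompact K := (isCompact_Icc.prod (isCompact_closedBall y₀ r)).prod isCompact_Icc
  have hKd : ContDiffOn ℝ 1 (scalWarp G) K := fun q hq =>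
    (contDiffAt_scalWarp (isInvertible_of_pos (hF _ (hin _ hq.1.1 _ hq.1.2).1).2.1)
      (hG _ (hin _ hq.1.1 _ hq.1.2).1)).contDiffWithinAt
  obtain ⟨L, hL⟩ := hKd.exists_lipschitzOnWith one_ne_zero hKconv hKcomp
  refine ⟨Metric.closedBall y₀ r, Metric.closedBall_mem_nhds _ hr0,
    fun y hy => (hin 0 ⟨le_rfl, hr0.le⟩ y hy).1.2, r, hr0,
    (hin r ⟨hr0.le, le_rfl⟩ y₀ (Metric.mem_closedBall_self hr0.le)).1.1.2, L / c, ?_⟩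
  intro k δ hk hδ h H t ht y hy
  obtain ⟨d0, d1, hth, hhδ, hdiff, hgr⟩ := H.estimates ht
  have htr : t ∈ Set.Icc 0 r := ⟨ht.1, ht.2.trans hδ⟩
  have hhr : h t ∈ Set.Icc 0 r := ⟨ht.1.trans hth, hhδ.trans hδ⟩
  obtain ⟨m1, -⟩ := hin t htr y hy
  obtain ⟨m2, m2'⟩ := hin (h t) hhr y hy
  rw [scalCoord_warp (z := (t, y)) (H.smooth.contDiffAt.of_le ENat.LEInfty.out)
    ((hG _ m2).of_le ENat.LEInfty.out) ((hopen.eventually_mem m2).mono hF),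
    ← scalWarp_one (isInvertible_of_pos (hF _ m1).2.1)
      ((hG _ m1).of_le ENat.LEInfty.out)]
  have hlip := hL.dist_le_mul ((t, y), 1) ⟨⟨htr, hy⟩, by simp⟩ ((h t, y), deriv h t)
    ⟨⟨hhr, hy⟩, d0, d1⟩
  have hdist : dist (((t, y), 1) : (ℝ × E) × ℝ) ((h t, y), deriv h t) ≤ 1 - deriv h t := by
    rw [Prod.dist_eq, Prod.dist_eq, dist_self, Real.dist_eq, Real.dist_eq, abs_sub_comm,
      abs_of_nonneg (by linarith : 0 ≤ h t - t), abs_of_nonneg (by linarith : 0 ≤ 1 - deriv h t)]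
    refine max_le (max_le ?_ (by linarith)) le_rfl
    have : δ * (1 - deriv h t) ≤ 1 * (1 - deriv h t) :=
      mul_le_mul_of_nonneg_right (hδ.trans hr1) (by linarith)
    linarith
  have h3 : scalWarp G ((t, y), 1) - scalWarp G ((h t, y), deriv h t) ≤ L * (1 - deriv h t) :=
    (le_abs_self _).trans (hlip.trans (mul_le_mul_of_nonneg_left hdist L.2))
  -- This is the origin of the threshold L / c: the gain c h'' ≥ c k (1 - h') beats the loss L (1 -
  -- h').
  have h4 : L ≤ k * c := by rwa [div_le_iff₀ hc0] at hk
  have h5 : L * (1 - deriv h t) ≤ k * c * (1 - deriv h t) :=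
    mul_le_mul_of_nonneg_right h4 (by linarith)
  have h6 : k * (1 - deriv h t) * c ≤ deriv (deriv h) t * c :=
    mul_le_mul_of_nonneg_right hgr hc0.le
  have h7 : deriv (deriv h) t * T (h t, y) ≤ deriv (deriv h) t * (-c) :=
    mul_le_mul_of_nonneg_left m2'.le (H.convex t)
  simp only [hT] at h7
  simp only
  nlinarith

end Local

/-! ### Fields of forms on a manifold, read in arbitrary local parametrizations -/

section Pullback

variable {m : ℕ}
  {H : Type*} [TopologicalSpace H] [ChartedSpace (EuclideanSpace ℝ (Fin m)) H]
  [IsManifold (𝓡 m) ∞ H]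
  {E : Type*} [NormedAddCommGroup E] [NormedSpace ℝ E]
  {F : Type*} [NormedAddCommGroup F] [NormedSpace ℝ F]

/-- The pull-back of a field of bilinear forms on `H` by a map from a coordinate space. -/
def pullback (s : ∀ x : H, TangentSpace (𝓡 m) x →L[ℝ] TangentSpace (𝓡 m) x →L[ℝ] ℝ)
    (ψ : E → H) (y : E) : E →L[ℝ] E →L[ℝ] ℝ :=
  ContinuousLinearMap.bilinearComp
    (E := EuclideanSpace ℝ (Fin m)) (F := EuclideanSpace ℝ (Fin m))
    (s (ψ y)) (mfderiv 𝓘(ℝ, E) (𝓡 m) ψ y) (mfderiv 𝓘(ℝ, E) (𝓡 m) ψ y)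

theorem pullback_apply (s : ∀ x : H, TangentSpace (𝓡 m) x →L[ℝ] TangentSpace (𝓡 m) x →L[ℝ] ℝ)
    (ψ : E → H) (y v w : E) :
    pullback s ψ y v w =
      s (ψ y) (mfderiv 𝓘(ℝ, E) (𝓡 m) ψ y v) (mfderiv 𝓘(ℝ, E) (𝓡 m) ψ y w) := rfl

/-- The trivialization of the bundle of forms precomposes with the inverse trivialization of the
tangent bundle, which is the differential of the inverse chart. Smoothness of a metric thereby
becomes smoothness of its coordinate expression. -/
theorem trivializationAt_form
    (s : ∀ x : H, TangentSpace (𝓡 m) x →L[ℝ] TangentSpace (𝓡 m) x →L[ℝ] ℝ) {x₀ x : H}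
    (hx : x ∈ (chartAt (EuclideanSpace ℝ (Fin m)) x₀).source) :
    (trivializationAt (EuclideanSpace ℝ (Fin m) →L[ℝ] EuclideanSpace ℝ (Fin m) →L[ℝ] ℝ)
      (fun x : H => TangentSpace (𝓡 m) x →L[ℝ] TangentSpace (𝓡 m) x →L[ℝ] ℝ) x₀ ⟨x, s x⟩).2 =
      pullback s (extChartAt (𝓡 m) x₀).symm (extChartAt (𝓡 m) x₀ x) := by
  have : IsManifold (𝓡 m) 1 H := IsManifold.of_le (n := ∞) ENat.LEInfty.out
  have h1 := TangentBundle.symmL_trivializationAt (I := 𝓡 m) hx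
  have h2 : (extChartAt (𝓡 m) x₀).symm (extChartAt (𝓡 m) x₀ x) = x :=
    (extChartAt (𝓡 m) x₀).left_inv (by rwa [extChartAt_source])
  have hr : Set.range (𝓡 m) = Set.univ := by simp
  rw [hr, mfderivWithin_univ] at h1
  ext v w
  rw [pullback_apply, ← h1, h2]
  simp [hom_trivializationAt_apply, ContinuousLinearMap.inCoordinates, hx,
    Bundle.Trivialization.linearMapAt_apply]
  rfl

theorem contMDiffAt_form_iff
    (s : ∀ x : H, TangentSpace (𝓡 m) x →L[ℝ] TangentSpace (𝓡 m) x →L[ℝ] ℝ) (x₀ : H) :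
    ContMDiffAt (𝓡 m) ((𝓡 m).prod
        𝓘(ℝ, EuclideanSpace ℝ (Fin m) →L[ℝ] EuclideanSpace ℝ (Fin m) →L[ℝ] ℝ)) ∞
      (fun x => Bundle.TotalSpace.mk' (EuclideanSpace ℝ (Fin m) →L[ℝ] EuclideanSpace ℝ (Fin m) →L[ℝ] ℝ)
        (E := fun x : H => TangentSpace (𝓡 m) x →L[ℝ] TangentSpace (𝓡 m) x →L[ℝ] ℝ) x (s x)) x₀ ↔
    ContDiffAt ℝ ∞ (pullback s (extChartAt (𝓡 m) x₀).symm) (extChartAt (𝓡 m) x₀ x₀) := by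
  rw [Bundle.contMDiffAt_section]
  have h1 : (fun x => (trivializationAt
      (EuclideanSpace ℝ (Fin m) →L[ℝ] EuclideanSpace ℝ (Fin m) →L[ℝ] ℝ)
      (fun x : H => TangentSpace (𝓡 m) x →L[ℝ] TangentSpace (𝓡 m) x →L[ℝ] ℝ) x₀ ⟨x, s x⟩).2)
      =ᶠ[𝓝 x₀] fun x => pullback s (extChartAt (𝓡 m) x₀).symm (extChartAt (𝓡 m) x₀ x) := by
    filter_upwards [(chartAt (EuclideanSpace ℝ (Fin m)) x₀).open_source.mem_nhds
      (mem_chart_source _ x₀)] with x hx using trivializationAt_form s hx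
  rw [h1.contMDiffAt_iff, ← contMDiffAt_iff_contDiffAt]
  constructor
  · intro h
    have h2 : ContMDiffAt 𝓘(ℝ, EuclideanSpace ℝ (Fin m)) (𝓡 m) ∞ (extChartAt (𝓡 m) x₀).symm
        (extChartAt (𝓡 m) x₀ x₀) := by
      have := contMDiffWithinAt_extChartAt_symm_range_self (I := 𝓡 m) (n := ∞) x₀
      rwa [show Set.range (𝓡 m) = Set.univ by simp, contMDiffWithinAt_univ] at this
    have h3 := ContMDiffAt.comp_of_eq h h2 (extChartAt_to_inv x₀)
    refine h3.congr_of_eventuallyEq ?_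
    filter_upwards [extChartAt_target_mem_nhds (I := 𝓡 m) x₀] with y hy
    simp only [Function.comp_apply, (extChartAt (𝓡 m) x₀).right_inv hy]
  · intro h
    exact ContMDiffAt.comp (g := pullback s (extChartAt (𝓡 m) x₀).symm) x₀ h
      contMDiffAt_extChartAt

variable [FiniteDimensional ℝ E] [FiniteDimensional ℝ F]
  {s : ∀ x : H, TangentSpace (𝓡 m) x →L[ℝ] TangentSpace (𝓡 m) x →L[ℝ] ℝ}

theorem pullback_comp {ψ : F → H} {φ : E → F} {y : E}
    (hψ : MDifferentiableAt 𝓘(ℝ, F) (𝓡 m) ψ (φ y)) (hφ : DifferentiableAt ℝ φ y) :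
    pullback s (ψ ∘ φ) y = pullForm φ (pullback s ψ) y := by
  ext v w
  rw [pullForm_apply, pullback_apply, pullback_apply,
    mfderiv_comp y hψ hφ.mdifferentiableAt, mfderiv_eq_fderiv]
  rfl

theorem form_congr {a b : H} (h : a = b) (v w : EuclideanSpace ℝ (Fin m)) :
    s a v w = s b v w := by
  subst h; rfl

theorem pullback_congr {ψ ψ' : E → H} {y : E} (h : ψ =ᶠ[𝓝 y] ψ') :
    pullback s ψ y = pullback s ψ' y := by
  have h1 := h.mfderiv_eq (I := 𝓘(ℝ, E)) (I' := 𝓡 m)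
  have h2 := h.eq_of_nhds
  ext v w
  rw [pullback_apply, pullback_apply, h1]
  exact form_congr h2 _ _

theorem contDiffAt_extChartAt_comp {n : ℕ∞ω} {ψ : E → H} {y : E}
    (hψ : ContMDiffAt 𝓘(ℝ, E) (𝓡 m) n ψ y) :
    ContDiffAt ℝ n (extChartAt (𝓡 m) (ψ y) ∘ ψ) y := by
  rw [← contMDiffAt_iff_contDiffAt]
  exact (contMDiffAt_iff_target.1 hψ).2

/-- Tangent vectors at a point are written in the preferred chart there, so the two differentials
agree by definition. The separate variable `x` avoids rewriting base points inside dependent types.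
-/
theorem mfderiv_eq_fderiv_extChartAt_comp {ψ : E → H} {y : E} {x : H} (hx : ψ y = x)
    (hψ : MDifferentiableAt 𝓘(ℝ, E) (𝓡 m) ψ y) (v : E) :
    (mfderiv 𝓘(ℝ, E) (𝓡 m) ψ y v : EuclideanSpace ℝ (Fin m)) =
      fderiv ℝ (extChartAt (𝓡 m) x ∘ ψ) y v := by
  subst hx
  simp [mfderiv, hψ, writtenInExtChartAt]
  rfl

theorem eventually_extChartAt_symm {ψ : E → H} {y : E} {x : H} (hx : ψ y = x)
    (hψ : ContinuousAt ψ y) :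
    ψ =ᶠ[𝓝 y] (extChartAt (𝓡 m) x).symm ∘ (extChartAt (𝓡 m) x ∘ ψ) := by
  subst hx
  filter_upwards [hψ (extChartAt_source_mem_nhds (I := 𝓡 m) (ψ y))] with z hz
  exact ((extChartAt (𝓡 m) (ψ y)).left_inv hz).symm

theorem contMDiffAt_extChartAt_symm_self (x : H) :
    ContMDiffAt 𝓘(ℝ, EuclideanSpace ℝ (Fin m)) (𝓡 m) ∞ (extChartAt (𝓡 m) x).symm
      (extChartAt (𝓡 m) x x) := by
  have := contMDiffWithinAt_extChartAt_symm_range_self (I := 𝓡 m) (n := ∞) x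
  rwa [show Set.range (𝓡 m) = Set.univ by simp, contMDiffWithinAt_univ] at this

theorem ContMDiffAt.eventually_mdifferentiableAt {ψ : E → H} {y : E}
    (hψ : ContMDiffAt 𝓘(ℝ, E) (𝓡 m) ∞ ψ y) :
    ∀ᶠ z in 𝓝 y, MDifferentiableAt 𝓘(ℝ, E) (𝓡 m) ψ z := by
  have : IsManifold (𝓡 m) 1 H := IsManifold.of_le (n := ∞) ENat.LEInfty.out
  have h1 : ContMDiffAt 𝓘(ℝ, E) (𝓡 m) 1 ψ y := hψ.of_le ENat.LEInfty.out
  filter_upwards [(contMDiffAt_iff_contMDiffAt_nhds (by simp)).1 h1] with z hz using hz.mdifferentiableAt (by simp)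

/-- In a chart of `H`, the pull-back by `ψ` is the pull-back of the coordinate expression. -/
theorem pullback_eventuallyEq {ψ : E → H} {y : E} (hψ : ContMDiffAt 𝓘(ℝ, E) (𝓡 m) ∞ ψ y) :
    pullback s ψ =ᶠ[𝓝 y] pullForm (extChartAt (𝓡 m) (ψ y) ∘ ψ)
      (pullback s (extChartAt (𝓡 m) (ψ y)).symm) := by
  have hφ := contDiffAt_extChartAt_comp hψ
  have e1 := (eventually_extChartAt_symm (m := m) rfl hψ.continuousAt).eventuallyEq_nhds
  have e2 : ∀ᶠ z in 𝓝 y, DifferentiableAt ℝ (extChartAt (𝓡 m) (ψ y) ∘ ψ) z :=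
    ((hφ.of_le (m := 1) ENat.LEInfty.out).eventually (by simp)).mono
      fun z hz => hz.differentiableAt (by simp)
  have e3 : ∀ᶠ z in 𝓝 y, MDifferentiableAt 𝓘(ℝ, EuclideanSpace ℝ (Fin m)) (𝓡 m)
      (extChartAt (𝓡 m) (ψ y)).symm ((extChartAt (𝓡 m) (ψ y) ∘ ψ) z) :=
    hφ.continuousAt (ContMDiffAt.eventually_mdifferentiableAt
      (contMDiffAt_extChartAt_symm_self (m := m) (ψ y)))
  filter_upwards [e1, e2, e3] with z h1 h2 h3
  rw [pullback_congr h1, pullback_comp h3 h2]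

theorem contDiffAt_coordMetric (g : Metric m H) (x : H) :
    ContDiffAt ℝ ∞ (pullback g.inner (extChartAt (𝓡 m) x).symm) (extChartAt (𝓡 m) x x) :=
  (contMDiffAt_form_iff g.inner x).1 (g.contMDiff x)

theorem contDiffAt_pullback (g : Metric m H) {ψ : E → H} {y : E}
    (hψ : ContMDiffAt 𝓘(ℝ, E) (𝓡 m) ∞ ψ y) : ContDiffAt ℝ ∞ (pullback g.inner ψ) y := by
  refine ContDiffAt.congr_of_eventuallyEq ?_ (pullback_eventuallyEq hψ)
  exact ContDiffAt.pullForm (n := ∞) (m := ∞) (by simp) (contDiffAt_extChartAt_comp hψ)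
    (contDiffAt_coordMetric g (ψ y))

theorem pullback_symm (g : Metric m H) (ψ : E → H) (y v w : E) :
    pullback g.inner ψ y v w = pullback g.inner ψ y w v := g.symm _ _ _

theorem pullback_pos (g : Metric m H) {ψ : E → H} {y : E}
    (hi : Function.Injective (mfderiv 𝓘(ℝ, E) (𝓡 m) ψ y)) {v : E} (hv : v ≠ 0) :
    0 < pullback g.inner ψ y v v :=
  g.pos _ _ fun h => hv (hi (h.trans (map_zero _).symm))

theorem isInvertible_coordMetric (g : Metric m H) (x : H) :
    (pullback g.inner (extChartAt (𝓡 m) x).symm (extChartAt (𝓡 m) x x)).IsInvertible := by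
  refine isInvertible_of_pos fun v hv => pullback_pos g ?_ hv
  have hs : (extChartAt (𝓡 m) x).symm (extChartAt (𝓡 m) x x) = x := extChartAt_to_inv x
  intro a b hab
  have h1 := fun a => mfderiv_eq_fderiv_extChartAt_comp hs
    ((contMDiffAt_extChartAt_symm_self x).mdifferentiableAt (by simp)) a
  have h2 : (extChartAt (𝓡 m) x) ∘ (extChartAt (𝓡 m) x).symm =ᶠ[𝓝 (extChartAt (𝓡 m) x x)] id := by
    filter_upwards [extChartAt_target_mem_nhds (I := 𝓡 m) x] with y hy
    exact (extChartAt (𝓡 m) x).right_inv hy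
  rw [h2.fderiv_eq, fderiv_id] at h1
  exact (h1 a).symm.trans (hab.trans (h1 b))

theorem isInvertible_fderiv_extChartAt_comp {ψ : E → H} {y : E} {x : H} (hx : ψ y = x)
    (hψ : MDifferentiableAt 𝓘(ℝ, E) (𝓡 m) ψ y)
    (hi : ∃ A : E ≃L[ℝ] EuclideanSpace ℝ (Fin m), ∀ v, mfderiv 𝓘(ℝ, E) (𝓡 m) ψ y v = A v) :
    (fderiv ℝ (extChartAt (𝓡 m) x ∘ ψ) y).IsInvertible := by
  obtain ⟨A, hA⟩ := hi
  refine ⟨A, ?_⟩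
  ext1 v
  rw [← mfderiv_eq_fderiv_extChartAt_comp hx hψ]
  exact (hA v).symm

/-- The scalar curvature can be computed in any local parametrization. -/
theorem scal_eq_scalCoord_pullback (g : Metric m H) {ψ : E → H} {y : E}
    (hψ : ContMDiffAt 𝓘(ℝ, E) (𝓡 m) ∞ ψ y)
    (hi : ∃ A : E ≃L[ℝ] EuclideanSpace ℝ (Fin m), ∀ v, mfderiv 𝓘(ℝ, E) (𝓡 m) ψ y v = A v) :
    scal g (ψ y) = scalCoord (pullback g.inner ψ) y := by
  rw [scalCoord_congr (pullback_eventuallyEq hψ), scalCoord_pullForm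
    ((contDiffAt_extChartAt_comp hψ).of_le ENat.LEInfty.out)
    (isInvertible_fderiv_extChartAt_comp rfl (hψ.mdifferentiableAt (by simp)) hi)
    ((contDiffAt_coordMetric g (ψ y)).of_le ENat.LEInfty.out)
    (Filter.Eventually.of_forall fun x => pullback_symm g _ x) (isInvertible_coordMetric g (ψ y))]
  rfl

/-- A field of bilinear forms is smooth if it is smooth in a local parametrization. -/
theorem contMDiffAt_form_of_pullback {ψ : E → H} {y : E}
    (hψ : ContMDiffAt 𝓘(ℝ, E) (𝓡 m) ∞ ψ y)
    (hi : ∃ A : E ≃L[ℝ] EuclideanSpace ℝ (Fin m), ∀ v, mfderiv 𝓘(ℝ, E) (𝓡 m) ψ y v = A v)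
    (hs : ContDiffAt ℝ ∞ (pullback s ψ) y) :
    ContMDiffAt (𝓡 m) ((𝓡 m).prod
        𝓘(ℝ, EuclideanSpace ℝ (Fin m) →L[ℝ] EuclideanSpace ℝ (Fin m) →L[ℝ] ℝ)) ∞
      (fun x => Bundle.TotalSpace.mk' (EuclideanSpace ℝ (Fin m) →L[ℝ] EuclideanSpace ℝ (Fin m) →L[ℝ] ℝ)
        (E := fun x : H => TangentSpace (𝓡 m) x →L[ℝ] TangentSpace (𝓡 m) x →L[ℝ] ℝ) x (s x))
      (ψ y) := by
  rw [contMDiffAt_form_iff]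
  have hφ := contDiffAt_extChartAt_comp hψ
  set φ := extChartAt (𝓡 m) (ψ y) ∘ ψ with hφdef
  obtain ⟨A, hA⟩ := isInvertible_fderiv_extChartAt_comp rfl (hψ.mdifferentiableAt (by simp)) hi
  have hA' : HasFDerivAt φ (A : E →L[ℝ] EuclideanSpace ℝ (Fin m)) y := by
    rw [hA]; exact (hφ.differentiableAt (by simp)).hasFDerivAt
  set θ := hφ.localInverse hA' (by simp) with hθdef
  have hθ : ContDiffAt ℝ ∞ θ (φ y) := hφ.to_localInverse hA' (by simp)
  have hθy : θ (φ y) = y := hφ.localInverse_apply_image hA' (by simp)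
  have hθr : ∀ᶠ z in 𝓝 (φ y), φ (θ z) = z :=
    (hφ.hasStrictFDerivAt' hA' (by simp)).eventually_right_inverse
  have hθc : Filter.Tendsto θ (𝓝 (φ y)) (𝓝 y) := by
    have := hθ.continuousAt; rwa [ContinuousAt, hθy] at this
  -- With θ a local inverse of the coordinate expression φ of ψ, the preferred chart is a
  -- reparametrization of ψ, and the form in that chart is the pull-back by θ of the form in the
  -- parametrization ψ.
  have e1 : (extChartAt (𝓡 m) (ψ y)).symm =ᶠ[𝓝 (φ y)] ψ ∘ θ := by
    have := hθc.eventually (eventually_extChartAt_symm (m := m) rfl hψ.continuousAt)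
    filter_upwards [hθr, this] with z h1 h2
    rw [Function.comp_apply, h2]
    exact congrArg _ h1.symm
  have e2 : ∀ᶠ z in 𝓝 (φ y), DifferentiableAt ℝ θ z :=
    ((hθ.of_le (m := 1) ENat.LEInfty.out).eventually (by simp)).mono
      fun z hz => hz.differentiableAt (by simp)
  have e3 := hθc.eventually (ContMDiffAt.eventually_mdifferentiableAt hψ)
  have e4 : pullback s (extChartAt (𝓡 m) (ψ y)).symm =ᶠ[𝓝 (φ y)] pullForm θ (pullback s ψ) := by
    filter_upwards [e1.eventuallyEq_nhds, e2, e3] with z h1 h2 h3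
    rw [pullback_congr h1, pullback_comp h3 h2]
  exact (ContDiffAt.pullForm (n := ∞) (m := ∞) (by simp) hθ (by rwa [hθy])).congr_of_eventuallyEq e4

end Pullback

/-! ### Fermi charts and the metric in them -/

section FermiChart

variable {m n : ℕ}
  {H : Type*} [TopologicalSpace H] [ChartedSpace (EuclideanSpace ℝ (Fin m)) H]
  [IsManifold (𝓡 m) ∞ H]
  {W : Type*} [TopologicalSpace W] [ChartedSpace (EuclideanSpace ℝ (Fin n)) W]
  [IsManifold (𝓡 n) ∞ W]

/-- The differential of `Φ : ℝ × W → H`, as a map between coordinate spaces. -/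
def dPhi (Φ : ℝ × W → H) (u : ℝ × W) :
    ℝ × EuclideanSpace ℝ (Fin n) →L[ℝ] EuclideanSpace ℝ (Fin m) :=
  mfderiv (𝓘(ℝ, ℝ).prod (𝓡 n)) (𝓡 m) Φ u

/-- The parametrization of `H` given by `Φ` and the preferred chart of `W` at `p`. -/
def fermiChart (Φ : ℝ × W → H) (p : W) (z : ℝ × EuclideanSpace ℝ (Fin n)) : H :=
  Φ (z.1, (extChartAt (𝓡 n) p).symm z.2)

/-- The differential of the inverse of the preferred chart of `W` at `p`. -/
def dChart (p : W) (y : EuclideanSpace ℝ (Fin n)) :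
    EuclideanSpace ℝ (Fin n) →L[ℝ] EuclideanSpace ℝ (Fin n) :=
  mfderiv 𝓘(ℝ, EuclideanSpace ℝ (Fin n)) (𝓡 n) (extChartAt (𝓡 n) p).symm y

theorem contMDiffAt_extChartAt_symm {p : W} {y : EuclideanSpace ℝ (Fin n)}
    (hy : y ∈ (extChartAt (𝓡 n) p).target) :
    ContMDiffAt 𝓘(ℝ, EuclideanSpace ℝ (Fin n)) (𝓡 n) ∞ (extChartAt (𝓡 n) p).symm y :=
  (contMDiffOn_extChartAt_symm p).contMDiffAt ((isOpen_extChartAt_target p).mem_nhds hy)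

theorem isInvertible_dChart {p : W} {y : EuclideanSpace ℝ (Fin n)}
    (hy : y ∈ (extChartAt (𝓡 n) p).target) : (dChart p y).IsInvertible := by
  have : IsManifold (𝓡 n) 1 W := IsManifold.of_le (n := ∞) ENat.LEInfty.out
  have h := isInvertible_mfderivWithin_extChartAt_symm (I := 𝓡 n) hy
  rw [show Set.range (𝓡 n) = Set.univ by simp, mfderivWithin_univ] at h
  exact h

/-- The tangent space at `p` is identified with the model space by this very chart, so its
differential is the identity at the centre. -/
theorem dChart_self (p : W) (v : EuclideanSpace ℝ (Fin n)) :
    dChart p (extChartAt (𝓡 n) p p) v = v := by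
  have h1 := mfderiv_eq_fderiv_extChartAt_comp (extChartAt_to_inv (I := 𝓡 n) p)
    ((contMDiffAt_extChartAt_symm_self p).mdifferentiableAt (by simp)) v
  have h2 : (extChartAt (𝓡 n) p) ∘ (extChartAt (𝓡 n) p).symm =ᶠ[𝓝 (extChartAt (𝓡 n) p p)] id := by
    filter_upwards [extChartAt_target_mem_nhds (I := 𝓡 n) p] with y hy
    exact (extChartAt (𝓡 n) p).right_inv hy
  rw [h2.fderiv_eq, fderiv_id] at h1
  exact h1

variable {Φ : ℝ × W → H}

theorem mfderiv_fermiChart {p : W} {z : ℝ × EuclideanSpace ℝ (Fin n)}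
    (hz : z.2 ∈ (extChartAt (𝓡 n) p).target)
    (hΦ : ContMDiffAt (𝓘(ℝ, ℝ).prod (𝓡 n)) (𝓡 m) ∞ Φ (z.1, (extChartAt (𝓡 n) p).symm z.2)) :
    ContMDiffAt 𝓘(ℝ, ℝ × EuclideanSpace ℝ (Fin n)) (𝓡 m) ∞ (fermiChart Φ p) z ∧
      ∀ v, mfderiv 𝓘(ℝ, ℝ × EuclideanSpace ℝ (Fin n)) (𝓡 m) (fermiChart Φ p) z v =
        dPhi Φ (z.1, (extChartAt (𝓡 n) p).symm z.2) (v.1, dChart p z.2 v.2) := by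
  have h1 : ContMDiffAt 𝓘(ℝ, ℝ × EuclideanSpace ℝ (Fin n)) 𝓘(ℝ, ℝ) ∞
      (Prod.fst : ℝ × EuclideanSpace ℝ (Fin n) → ℝ) z := contDiff_fst.contMDiff.contMDiffAt
  have h2 : ContMDiffAt 𝓘(ℝ, ℝ × EuclideanSpace ℝ (Fin n)) 𝓘(ℝ, EuclideanSpace ℝ (Fin n)) ∞
      (Prod.snd : ℝ × EuclideanSpace ℝ (Fin n) → EuclideanSpace ℝ (Fin n)) z :=
    contDiff_snd.contMDiff.contMDiffAt
  have h0 := contMDiffAt_extChartAt_symm hz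
  have h3 : ContMDiffAt 𝓘(ℝ, ℝ × EuclideanSpace ℝ (Fin n)) (𝓡 n) ∞
      (fun z : ℝ × EuclideanSpace ℝ (Fin n) => (extChartAt (𝓡 n) p).symm z.2) z :=
    ContMDiffAt.comp z h0 h2
  refine ⟨ContMDiffAt.comp z (g := Φ) hΦ (h1.prodMk h3), fun v => ?_⟩
  have e1 := mfderiv_comp z (g := Φ) (hΦ.mdifferentiableAt (by simp))
    ((h1.prodMk h3).mdifferentiableAt (by simp))
  have e2 := mfderiv_prodMk (h1.mdifferentiableAt (by simp)) (h3.mdifferentiableAt (by simp))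
  have e3 := mfderiv_comp z (g := (extChartAt (𝓡 n) p).symm) (h0.mdifferentiableAt (by simp))
    (h2.mdifferentiableAt (by simp))
  have e4 := (mfderiv_eq_fderiv (𝕜 := ℝ) (f := (Prod.fst : ℝ × EuclideanSpace ℝ (Fin n) → ℝ))
    (x := z)).trans fderiv_fst
  have e5 := (mfderiv_eq_fderiv (𝕜 := ℝ)
    (f := (Prod.snd : ℝ × EuclideanSpace ℝ (Fin n) → EuclideanSpace ℝ (Fin n)))
    (x := z)).trans fderiv_snd
  rw [show fermiChart Φ p = Φ ∘ fun z => (z.1, (extChartAt (𝓡 n) p).symm z.2) from rfl, e1, e2]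
  rw [show (fun z : ℝ × EuclideanSpace ℝ (Fin n) => (extChartAt (𝓡 n) p).symm z.2) =
    (extChartAt (𝓡 n) p).symm ∘ Prod.snd from rfl, e3, e4, e5]
  rfl

theorem dt_eq_dPhi {t : ℝ} {p : W}
    (hΦ : MDifferentiableAt (𝓘(ℝ, ℝ).prod (𝓡 n)) (𝓡 m) Φ (t, p)) :
    dt (m := m) Φ t p = dPhi (m := m) (n := n) Φ (t, p) (1, 0) := by
  have h1 : MDifferentiableAt 𝓘(ℝ, ℝ) (𝓘(ℝ, ℝ).prod (𝓡 n)) (fun s : ℝ => (s, p)) t :=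
    mdifferentiableAt_id.prodMk mdifferentiableAt_const
  have h2 := mfderiv_comp t (g := Φ) hΦ h1
  rw [dt, show (fun s : ℝ => Φ (s, p)) = Φ ∘ fun s => (s, p) from rfl, h2, mfderiv_prod_left]
  rfl

theorem dslice_eq_dPhi {t : ℝ} {p : W}
    (hΦ : MDifferentiableAt (𝓘(ℝ, ℝ).prod (𝓡 n)) (𝓡 m) Φ (t, p)) (v : TangentSpace (𝓡 n) p) :
    dslice (m := m) Φ t p v = dPhi (m := m) (n := n) Φ (t, p) (0, v) := by
  have h1 : MDifferentiableAt (𝓡 n) (𝓘(ℝ, ℝ).prod (𝓡 n)) (fun q : W => (t, q)) p :=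
    mdifferentiableAt_const.prodMk mdifferentiableAt_id
  have h2 := mfderiv_comp p (g := Φ) hΦ h1
  rw [dslice, show (fun q : W => Φ (t, q)) = Φ ∘ fun q => (t, q) from rfl, h2, mfderiv_prod_right]
  rfl

variable {g : Metric m H} {ι : W → H} {ν : ∀ p : W, TangentSpace (𝓡 m) (ι p)} {σ : ℝ}

theorem IsFermi.contMDiffAt (hΦ : IsFermi (n := n) g ι ν σ Φ) {t : ℝ} (ht : t ∈ Set.Ioo (-σ) σ)
    (p : W) : ContMDiffAt (𝓘(ℝ, ℝ).prod (𝓡 n)) (𝓡 m) ∞ Φ (t, p) :=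
  (hΦ.isLocalDiffeomorphOn ⟨(t, p), ht, trivial⟩).contMDiffAt

theorem IsFermi.mdifferentiableAt (hΦ : IsFermi (n := n) g ι ν σ Φ) {t : ℝ}
    (ht : t ∈ Set.Ioo (-σ) σ) (p : W) :
    MDifferentiableAt (𝓘(ℝ, ℝ).prod (𝓡 n)) (𝓡 m) Φ (t, p) :=
  (hΦ.contMDiffAt ht p).mdifferentiableAt (by simp)

theorem IsFermi.isInvertible_dPhi (hΦ : IsFermi (n := n) g ι ν σ Φ) {t : ℝ}
    (ht : t ∈ Set.Ioo (-σ) σ) (p : W) : (dPhi (m := m) (n := n) Φ (t, p)).IsInvertible :=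
  ⟨(hΦ.isLocalDiffeomorphOn ⟨(t, p), ht, trivial⟩).mfderivToContinuousLinearEquiv (by simp), rfl⟩

theorem IsFermi.contMDiffAt_fermiChart (hΦ : IsFermi (n := n) g ι ν σ Φ) {p : W}
    {z : ℝ × EuclideanSpace ℝ (Fin n)}
    (hz : z ∈ Set.Ioo (-σ) σ ×ˢ (extChartAt (𝓡 n) p).target) :
    ContMDiffAt 𝓘(ℝ, ℝ × EuclideanSpace ℝ (Fin n)) (𝓡 m) ∞ (fermiChart Φ p) z :=
  (mfderiv_fermiChart hz.2 (hΦ.contMDiffAt hz.1 _)).1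

theorem IsFermi.mfderiv_fermiChart (hΦ : IsFermi (n := n) g ι ν σ Φ) {p : W}
    {z : ℝ × EuclideanSpace ℝ (Fin n)}
    (hz : z ∈ Set.Ioo (-σ) σ ×ˢ (extChartAt (𝓡 n) p).target) (v : ℝ × EuclideanSpace ℝ (Fin n)) :
    mfderiv 𝓘(ℝ, ℝ × EuclideanSpace ℝ (Fin n)) (𝓡 m) (fermiChart Φ p) z v =
      dPhi Φ (z.1, (extChartAt (𝓡 n) p).symm z.2) (v.1, dChart p z.2 v.2) :=
  (FermiDoubling.mfderiv_fermiChart hz.2 (hΦ.contMDiffAt hz.1 _)).2 v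

theorem IsFermi.exists_equiv (hΦ : IsFermi (n := n) g ι ν σ Φ) {p : W}
    {z : ℝ × EuclideanSpace ℝ (Fin n)}
    (hz : z ∈ Set.Ioo (-σ) σ ×ˢ (extChartAt (𝓡 n) p).target) :
    ∃ A : (ℝ × EuclideanSpace ℝ (Fin n)) ≃L[ℝ] EuclideanSpace ℝ (Fin m),
      ∀ v, mfderiv 𝓘(ℝ, ℝ × EuclideanSpace ℝ (Fin n)) (𝓡 m) (fermiChart Φ p) z v = A v := by
  obtain ⟨a, ha⟩ := isInvertible_dChart hz.2
  obtain ⟨b, hb⟩ := hΦ.isInvertible_dPhi hz.1 ((extChartAt (𝓡 n) p).symm z.2)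
  refine ⟨((ContinuousLinearEquiv.refl ℝ ℝ).prodCongr a).trans b, fun v => ?_⟩
  rw [hΦ.mfderiv_fermiChart hz v, ← ha, ← hb]
  rfl

/-- The scalar product at a point of `H`, on the coordinate space. -/
def innerAt (g : Metric m H) (x : H) :
    EuclideanSpace ℝ (Fin m) →L[ℝ] EuclideanSpace ℝ (Fin m) →L[ℝ] ℝ := g.inner x

theorem IsFermi.innerAt_dPhi (hΦ : IsFermi (n := n) g ι ν σ Φ) {t : ℝ} (ht : t ∈ Set.Ioo (-σ) σ)
    (p : W) (v : ℝ × EuclideanSpace ℝ (Fin n)) :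
    innerAt g (Φ (t, p)) (dPhi (n := n) Φ (t, p) (1, 0)) (dPhi Φ (t, p) v) = v.1 := by
  obtain ⟨h1, h2, -⟩ := hΦ.hasForm t ht p
  have hd := hΦ.mdifferentiableAt ht p
  have e1 := dt_eq_dPhi hd
  have e2 := dslice_eq_dPhi hd v.2
  have h1' : innerAt g (Φ (t, p)) (dPhi (n := n) Φ (t, p) (1, 0)) (dPhi (n := n) Φ (t, p) (1, 0)) = 1 :=
    (congrArg₂ (fun a b => innerAt g (Φ (t, p)) a b) e1 e1).symm.trans h1
  have h2' : innerAt g (Φ (t, p)) (dPhi (n := n) Φ (t, p) (1, 0)) (dPhi Φ (t, p) (0, v.2)) = 0 :=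
    (congrArg₂ (fun a b => innerAt g (Φ (t, p)) a b) e1 e2).symm.trans (h2 v.2)
  have h3 : v = v.1 • ((1 : ℝ), (0 : EuclideanSpace ℝ (Fin n))) + (0, v.2) := by
    ext <;> simp
  conv_lhs => rw [h3]
  rw [map_add, map_smul, map_add, map_smul, h1', h2', smul_eq_mul, mul_one, add_zero]

theorem IsFermi.pullback_fermiChart (hΦ : IsFermi (n := n) g ι ν σ Φ) (g' : Metric m H) {p : W}
    {z : ℝ × EuclideanSpace ℝ (Fin n)}
    (hz : z ∈ Set.Ioo (-σ) σ ×ˢ (extChartAt (𝓡 n) p).target) (v w : ℝ × EuclideanSpace ℝ (Fin n)) :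
    pullback g'.inner (fermiChart Φ p) z v w =
      innerAt g' (Φ (z.1, (extChartAt (𝓡 n) p).symm z.2))
        (dPhi Φ (z.1, (extChartAt (𝓡 n) p).symm z.2) (v.1, dChart p z.2 v.2))
        (dPhi Φ (z.1, (extChartAt (𝓡 n) p).symm z.2) (w.1, dChart p z.2 w.2)) := by
  rw [pullback_apply]
  exact congrArg₂ (fun a b => innerAt g' (Φ (z.1, (extChartAt (𝓡 n) p).symm z.2)) a b)
    (hΦ.mfderiv_fermiChart hz v) (hΦ.mfderiv_fermiChart hz w)

theorem IsFermi.isFermiForm (hΦ : IsFermi (n := n) g ι ν σ Φ) {p : W}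
    {z : ℝ × EuclideanSpace ℝ (Fin n)}
    (hz : z ∈ Set.Ioo (-σ) σ ×ˢ (extChartAt (𝓡 n) p).target) :
    IsFermiForm (pullback g.inner (fermiChart Φ p)) z := by
  refine ⟨pullback_symm g _ z, fun v hv => pullback_pos g ?_ hv, fun v => ?_⟩
  · obtain ⟨A, hA⟩ := hΦ.exists_equiv hz
    intro a b hab
    exact A.injective ((hA a).symm.trans (hab.trans (hA b)))
  · rw [hΦ.pullback_fermiChart g hz]
    simp only [map_zero]
    exact hΦ.innerAt_dPhi hz.1 _ _

section SecondDeriv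

variable {E : Type*} [NormedAddCommGroup E] [NormedSpace ℝ E] [FiniteDimensional ℝ E]

/-- The Christoffel map of a metric `dt² + g_t`, on vectors tangent to the slices. -/
theorem IsFermiForm.christoffel_fst {G : ℝ × E → ℝ × E →L[ℝ] ℝ × E →L[ℝ] ℝ} {z : ℝ × E}
    (hF : ∀ᶠ z' in 𝓝 z, IsFermiForm G z') (hG : DifferentiableAt ℝ G z) (v w : E) :
    (christoffel G z (0, v) (0, w)).1 = -(1 / 2) * fderiv ℝ G z (1, 0) (0, v) (0, w) := by
  obtain ⟨hs, hp, h1⟩ := hF.self_of_nhds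
  have h0 := fun u w => (IsFermiForm.fderiv_eq_zero hF hG u ((0 : ℝ), w)).2
  rw [← h1, hs, metric_christoffel (isInvertible_of_pos hp), h0, h0]
  ring

/-- The trace over `ℝ × E` of a bilinear form that vanishes on the first factor. -/
theorem IsFermiForm.metricTrace_eq {G : ℝ × E → ℝ × E →L[ℝ] ℝ × E →L[ℝ] ℝ} {z : ℝ × E}
    (hF : IsFermiForm G z) (β : ℝ × E →L[ℝ] ℝ × E →L[ℝ] ℝ)
    (hβ : ∀ v, β v (1, 0) = 0) (hβ' : ∀ v, β (1, 0) v = 0) :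
    metricTrace (G z) (fun v w => β v w) =
      metricTrace ((G z).bilinearComp (ContinuousLinearMap.inr ℝ ℝ E)
        (ContinuousLinearMap.inr ℝ ℝ E)) (fun v w => β (0, v) (0, w)) := by
  obtain ⟨hs, hp, h1⟩ := hF
  have hi := isInvertible_of_pos hp
  have hi' : ((G z).bilinearComp (ContinuousLinearMap.inr ℝ ℝ E)
      (ContinuousLinearMap.inr ℝ ℝ E)).IsInvertible := by
    refine isInvertible_of_pos fun v hv => hp (0, v) ?_
    simpa using hv
  set g₀ := (G z).bilinearComp (ContinuousLinearMap.inr ℝ ℝ E) (ContinuousLinearMap.inr ℝ ℝ E)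
  let β₀ : E →L[ℝ] E →L[ℝ] ℝ :=
    β.bilinearComp (ContinuousLinearMap.inr ℝ ℝ E) (ContinuousLinearMap.inr ℝ ℝ E)
  have e1 := metricTrace_eq_trace (G z) β.toLinearMap₁₂
  have e2 := metricTrace_eq_trace g₀ β₀.toLinearMap₁₂
  -- Both the scalar product and β are block diagonal for the splitting ℝ × E, and β has zero block
  -- on ℝ; hence the raised endomorphism is 0 ⊕ `raise g₀ β₀`.
  have e3 : raise (G z) β.toLinearMap₁₂ =
      LinearMap.prodMap (0 : ℝ →ₗ[ℝ] ℝ) (raise g₀ β₀.toLinearMap₁₂) := by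
    refine LinearMap.ext fun v => ?_
    have hv : raise (G z) β.toLinearMap₁₂ v = (G z).inverse (β v) := rfl
    have hv' : raise g₀ β₀.toLinearMap₁₂ v.2 = g₀.inverse (β₀ v.2) := rfl
    rw [hv, LinearMap.prodMap_apply, hv', LinearMap.zero_apply]
    rw [show β v = G z (0, g₀.inverse (β₀ v.2)) from ?_, inverse_apply_apply hi]
    refine ContinuousLinearMap.ext fun w => ?_
    have k1 : ∀ w : ℝ × E, w = w.1 • ((1 : ℝ), (0 : E)) + (0, w.2) := fun w => by ext <;> simp
    have k2 : G z (0, g₀.inverse (β₀ v.2)) (0, w.2) = β (0, v.2) (0, w.2) :=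
      congrArg (fun L : E →L[ℝ] ℝ => L w.2) (apply_inverse_apply hi' (β₀ v.2))
    have k3 : G z (0, g₀.inverse (β₀ v.2)) (1, 0) = 0 := by rw [hs, h1]
    have k4 : β v w = β v (0, w.2) := by
      have := congrArg (β v) (k1 w)
      rwa [map_add, map_smul, hβ, smul_zero, zero_add] at this
    have k5 : β v (0, w.2) = β (0, v.2) (0, w.2) := by
      have := congrArg (fun u => β u (0, w.2)) (k1 v)
      simpa only [map_add, map_smul, add_apply, smul_apply, hβ', smul_zero, zero_add] using this
    have k6 := congrArg (G z (0, g₀.inverse (β₀ v.2))) (k1 w)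
    rw [map_add, map_smul, k2, k3, smul_zero, zero_add] at k6
    rw [k4, k5, k6]
  rw [e3, LinearMap.trace_prodMap', map_zero, zero_add, ← e2] at e1
  exact e1

end SecondDeriv

end FermiChart

/-! ### The second fundamental form and mean curvature in Fermi coordinates -/

section SecondFundamentalForm

variable {m n : ℕ}
  {H : Type*} [TopologicalSpace H] [ChartedSpace (EuclideanSpace ℝ (Fin m)) H]
  [IsManifold (𝓡 m) ∞ H]
  {W : Type*} [TopologicalSpace W] [ChartedSpace (EuclideanSpace ℝ (Fin n)) W]
  [IsManifold (𝓡 n) ∞ W]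
  {Φ : ℝ × W → H} {g : Metric m H} {ι : W → H} {ν : ∀ p : W, TangentSpace (𝓡 m) (ι p)} {σ : ℝ}

theorem IsFermi.apply_zero (hΦ : IsFermi (n := n) g ι ν σ Φ) : ι = fun p => Φ (0, p) :=
  funext fun p => (congrArg Bundle.TotalSpace.proj (hΦ.initial p)).symm

theorem IsFermi.zero_mem (hΦ : IsFermi (n := n) g ι ν σ Φ) : (0 : ℝ) ∈ Set.Ioo (-σ) σ :=
  ⟨by linarith [hΦ.pos], hΦ.pos⟩

theorem IsFermi.pullback_fermiChart_self (hΦ : IsFermi (n := n) g ι ν σ Φ) (g' : Metric m H)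
    (p : W) {t : ℝ} (ht : t ∈ Set.Ioo (-σ) σ) (v w : ℝ × EuclideanSpace ℝ (Fin n)) :
    pullback g'.inner (fermiChart Φ p) (t, extChartAt (𝓡 n) p p) v w =
      innerAt g' (Φ (t, p)) (dPhi Φ (t, p) v) (dPhi Φ (t, p) w) := by
  rw [hΦ.pullback_fermiChart g' ⟨ht, mem_extChartAt_target p⟩]
  simp only [dChart_self, extChartAt_to_inv]

/-- The second fundamental form in a metric `dt² + g_t`. -/
theorem IsFermi.exists_secondDeriv_eq (hΦ : IsFermi (n := n) g ι ν σ Φ) (g' : Metric m H) (p : W)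
    (hF : ∀ᶠ z in 𝓝 ((0 : ℝ), extChartAt (𝓡 n) p p),
      IsFermiForm (pullback g'.inner (fermiChart Φ p)) z) (v w : EuclideanSpace ℝ (Fin n)) :
    ∃ x : EuclideanSpace ℝ (Fin n), (secondDeriv g' ι p v w : EuclideanSpace ℝ (Fin m)) =
      dPhi Φ (0, p) (-(1 / 2) * fderiv ℝ (pullback g'.inner (fermiChart Φ p))
        (0, extChartAt (𝓡 n) p p) (1, 0) (0, v) (0, w), x) := by
  obtain rfl := hΦ.apply_zero
  set y₀ := extChartAt (𝓡 n) p p with hy₀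
  have hz : ((0 : ℝ), y₀) ∈ Set.Ioo (-σ) σ ×ˢ (extChartAt (𝓡 n) p).target :=
    ⟨hΦ.zero_mem, mem_extChartAt_target p⟩
  have hψ := hΦ.contMDiffAt_fermiChart hz
  have hx : fermiChart Φ p (0, y₀) = Φ (0, p) := by
    simp only [fermiChart, hy₀, extChartAt_to_inv]
  set φ : ℝ × EuclideanSpace ℝ (Fin n) → EuclideanSpace ℝ (Fin m) :=
    extChartAt (𝓡 m) (Φ (0, p)) ∘ fermiChart Φ p with hφdef
  have hφ : ContDiffAt ℝ ∞ φ (0, y₀) := by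
    have := contDiffAt_extChartAt_comp hψ; rwa [hx] at this
  have hG : pullback g'.inner (fermiChart Φ p) =ᶠ[𝓝 (0, y₀)]
      pullForm φ (coordMetric g' (Φ (0, p))) := by
    have := pullback_eventuallyEq (s := g'.inner) hψ; rwa [hx] at this
  have hφy : φ (0, y₀) = extChartAt (𝓡 m) (Φ (0, p)) (Φ (0, p)) := by
    rw [hφdef, Function.comp_apply, hx]
  have hA := isInvertible_fderiv_extChartAt_comp hx (hψ.mdifferentiableAt (by simp))
    (hΦ.exists_equiv hz)
  have hγ : ContDiffAt ℝ ∞ (coordMetric g' (Φ (0, p))) (φ (0, y₀)) := by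
    rw [hφy]; exact contDiffAt_coordMetric g' _
  have hi : (coordMetric g' (Φ (0, p)) (φ (0, y₀))).IsInvertible := by
    rw [hφy]; exact isInvertible_coordMetric g' _
  -- Applied to vectors tangent to the slice, the right-hand side of the transformation law is the
  -- coordinate formula for `secondDeriv`. Thus the second derivative is the image of the
  -- Christoffel vector of the Fermi metric, whose t-component is -1/2 ∂_t g(v, w).
  have law := fderiv_christoffel_pullForm (hφ.of_le ENat.LEInfty.out) hA
    (hγ.differentiableAt (by simp)) (pullback_symm g' _ _) hi (0, v) (0, w)
  have hchr : christoffel (pullForm φ (coordMetric g' (Φ (0, p)))) (0, y₀) =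
      christoffel (pullback g'.inner (fermiChart Φ p)) (0, y₀) := by
    funext a b
    rw [christoffel, christoffel, hG.fderiv_eq, hG.eq_of_nhds]
  have hj : ∀ y, HasFDerivAt (fun y : EuclideanSpace ℝ (Fin n) => ((0 : ℝ), y))
      (ContinuousLinearMap.inr ℝ ℝ (EuclideanSpace ℝ (Fin n))) y := fun y =>
    (ContinuousLinearMap.inr ℝ ℝ (EuclideanSpace ℝ (Fin n))).hasFDerivAt
  have hd1 : ∀ᶠ y in 𝓝 y₀, DifferentiableAt ℝ φ (0, y) := by
    have h1 : ∀ᶠ z in 𝓝 ((0 : ℝ), y₀), DifferentiableAt ℝ φ z :=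
      ((hφ.of_le (m := 1) ENat.LEInfty.out).eventually (by simp)).mono
        fun z hz => hz.differentiableAt (by simp)
    exact (hj y₀).continuousAt h1
  have hf : ∀ᶠ y in 𝓝 y₀, ∀ w, fderiv ℝ (fun y => φ (0, y)) y w = fderiv ℝ φ (0, y) (0, w) := by
    filter_upwards [hd1] with y hy w
    exact congrArg (fun L : _ →L[ℝ] EuclideanSpace ℝ (Fin m) => L w)
      (hy.hasFDerivAt.comp y (hj y)).fderiv
  have hdd : fderiv ℝ (fun y => fderiv ℝ (fun y => φ (0, y)) y w) y₀ v =
      fderiv ℝ (fderiv ℝ φ) (0, y₀) (0, v) (0, w) := by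
    have e1 : (fun y => fderiv ℝ (fun y => φ (0, y)) y w) =ᶠ[𝓝 y₀]
      fun y => fderiv ℝ φ (0, y) (0, w) := hf.mono fun y hy => hy w
    have e2 : HasFDerivAt (fderiv ℝ φ) (fderiv ℝ (fderiv ℝ φ) (0, y₀)) (0, y₀) :=
      ((hφ.fderiv_right (m := 1) (by norm_num; exact ENat.LEInfty.out)).differentiableAt (by simp)).hasFDerivAt
    have e3 := (e2.comp y₀ (hj y₀)).clm_apply (hasFDerivAt_const ((0 : ℝ), w) y₀)
    simp only [Function.comp_def] at e3
    rw [e1.fderiv_eq, e3.fderiv]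
    simp
  have hsec : (secondDeriv g' (fun p => Φ (0, p)) p v w : EuclideanSpace ℝ (Fin m)) =
      fderiv ℝ φ (0, y₀) (christoffel (pullback g'.inner (fermiChart Φ p)) (0, y₀) (0, v) (0, w)) := by
    rw [← hchr, law, ← hdd, ← hf.self_of_nhds, ← hf.self_of_nhds]
    rfl
  have hfst := IsFermiForm.christoffel_fst hF
    ((contDiffAt_pullback g' hψ).differentiableAt (by simp)) v w
  refine ⟨(christoffel (pullback g'.inner (fermiChart Φ p)) (0, y₀) (0, v) (0, w)).2, ?_⟩
  rw [hsec, ← hfst, ← mfderiv_eq_fderiv_extChartAt_comp hx (hψ.mdifferentiableAt (by simp))]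
  refine (hΦ.mfderiv_fermiChart hz _).trans ?_
  simp only [hy₀, dChart_self, extChartAt_to_inv]
  rfl

theorem IsFermi.eventually_isFermiForm (hΦ : IsFermi (n := n) g ι ν σ Φ) (p : W)
    {z : ℝ × EuclideanSpace ℝ (Fin n)}
    (hz : z ∈ Set.Ioo (-σ) σ ×ˢ (extChartAt (𝓡 n) p).target) :
    ∀ᶠ z in 𝓝 z, IsFermiForm (pullback g.inner (fermiChart Φ p)) z :=
  ((isOpen_Ioo.prod (isOpen_extChartAt_target p)).eventually_mem hz).mono
    fun _ h => hΦ.isFermiForm h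

theorem IsFermi.mfderiv_eq_dPhi (hΦ : IsFermi (n := n) g ι ν σ Φ) (p : W)
    (v : EuclideanSpace ℝ (Fin n)) :
    (mfderiv (𝓡 n) (𝓡 m) ι p v : EuclideanSpace ℝ (Fin m)) = dPhi Φ (0, p) (0, v) := by
  obtain rfl := hΦ.apply_zero
  exact dslice_eq_dPhi (hΦ.mdifferentiableAt hΦ.zero_mem p) v

/-- The initial condition is an equality in the tangent bundle; once ι is replaced by the slice t =
0, its fibre component is an honest equality of vectors. -/
theorem IsFermi.normal_eq_dPhi (hΦ : IsFermi (n := n) g ι ν σ Φ) (p : W) :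
    (ν p : EuclideanSpace ℝ (Fin m)) = dPhi (n := n) Φ (0, p) (1, 0) := by
  obtain rfl := hΦ.apply_zero
  rw [← dt_eq_dPhi (hΦ.mdifferentiableAt hΦ.zero_mem p)]
  have h := hΦ.initial p
  exact (eq_of_heq (Bundle.TotalSpace.mk.inj h).2).symm

/-- The mean curvature is minus one half of the trace of the derivative of `g_t`. -/
theorem IsFermi.meanCurvature_eq (hΦ : IsFermi (n := n) g ι ν σ Φ) (p : W) :
    meanCurvature (n := n) g ι ν p = -(1 / 2) *
      metricTrace (pullback g.inner (fermiChart Φ p) (0, extChartAt (𝓡 n) p p))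
        (fun v w => fderiv ℝ (pullback g.inner (fermiChart Φ p)) (0, extChartAt (𝓡 n) p p)
          (1, 0) v w) := by
  have hz : ((0 : ℝ), extChartAt (𝓡 n) p p) ∈ Set.Ioo (-σ) σ ×ˢ (extChartAt (𝓡 n) p).target :=
    ⟨hΦ.zero_mem, mem_extChartAt_target p⟩
  have hF := hΦ.eventually_isFermiForm p hz
  have hβ := IsFermiForm.fderiv_eq_zero hF
    ((contDiffAt_pullback g (hΦ.contMDiffAt_fermiChart hz)).differentiableAt (by simp)) (1, 0)
  have hx : Φ (0, p) = ι p := (congrFun hΦ.apply_zero p).symm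
  have e1 : inducedMetric (n := n) g ι p =
      (pullback g.inner (fermiChart Φ p) (0, extChartAt (𝓡 n) p p)).bilinearComp
        (ContinuousLinearMap.inr ℝ ℝ _) (ContinuousLinearMap.inr ℝ ℝ _) := by
    ext v w
    rw [ContinuousLinearMap.bilinearComp_apply, hΦ.pullback_fermiChart_self g p hΦ.zero_mem, hx]
    exact congrArg₂ (fun a b => innerAt g (ι p) a b) (hΦ.mfderiv_eq_dPhi p v)
      (hΦ.mfderiv_eq_dPhi p w)
  have e2 : ∀ v w : EuclideanSpace ℝ (Fin n),
      g.inner (ι p) (secondDeriv (n := n) g ι p v w) (ν p) =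
      -(1 / 2) * fderiv ℝ (pullback g.inner (fermiChart Φ p)) (0, extChartAt (𝓡 n) p p)
          (1, 0) (0, v) (0, w) := by
    intro v w
    obtain ⟨x, hx'⟩ := hΦ.exists_secondDeriv_eq g p hF v w
    refine (congrArg₂ (fun a b => innerAt g (ι p) a b) hx' (hΦ.normal_eq_dPhi p)).trans ?_
    have hsym : ∀ a b, innerAt g (ι p) a b = innerAt g (ι p) b a := g.symm (ι p)
    change innerAt g (ι p) _ _ = _
    -- Pairing with ν, the image of ∂_t, reads off the t-component and discards the unspecified
    -- tangential part.
    rw [hsym, ← hx, hΦ.innerAt_dPhi hΦ.zero_mem]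
  rw [IsFermiForm.metricTrace_eq hF.self_of_nhds _ (fun v => (hβ v).2) (fun v => (hβ v).1), ← e1,
    meanCurvature]
  refine (congrArg (metricTrace (inducedMetric (n := n) g ι p))
    (funext fun v => funext fun w => e2 v w)).trans ?_
  simp only [metricTrace, Finset.mul_sum]
  exact Finset.sum_congr rfl fun i _ => Finset.sum_congr rfl fun j _ => by ring

/-- The normal component of ∇_v w is -1/2 ∂_t g'(v, w), so what remains is the image of a vector
tangent to `W`. -/
theorem IsFermi.isTotallyGeodesic (hΦ : IsFermi (n := n) g ι ν σ Φ) (g' : Metric m H)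
    (hF : ∀ p, ∀ᶠ z in 𝓝 ((0 : ℝ), extChartAt (𝓡 n) p p),
      IsFermiForm (pullback g'.inner (fermiChart Φ p)) z)
    (hd : ∀ p, fderiv ℝ (pullback g'.inner (fermiChart Φ p)) (0, extChartAt (𝓡 n) p p)
      (1, 0) = 0) : IsTotallyGeodesic (n := n) g' ι := by
  intro p v w
  obtain ⟨x, hx⟩ := hΦ.exists_secondDeriv_eq g' p (hF p) v w
  rw [hd p] at hx
  refine ⟨x, (hΦ.mfderiv_eq_dPhi p x).trans (hx.trans ?_).symm⟩
  simp
  rfl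

end SecondFundamentalForm

/-! ### Reparametrizing the normal direction and gluing to a smooth metric -/

section Bending

variable {m n : ℕ}
  {H : Type*} [TopologicalSpace H] [ChartedSpace (EuclideanSpace ℝ (Fin m)) H]
  [IsManifold (𝓡 m) ∞ H]
  {W : Type*} [TopologicalSpace W] [ChartedSpace (EuclideanSpace ℝ (Fin n)) W]
  [IsManifold (𝓡 n) ∞ W]
  {Φ : ℝ × W → H} {g g' : Metric m H} {ι : W → H} {ν : ∀ p : W, TangentSpace (𝓡 m) (ι p)}
  {σ : ℝ} {η : ℝ → ℝ}

open Classical in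
/-- The field of forms obtained from `g` by replacing `dt² + g_t` by `dt² + g_{η t}`. -/
def bentForm (g : Metric m H) (Φ : ℝ × W → H) (σ : ℝ) (η : ℝ → ℝ) (x : H) :
    EuclideanSpace ℝ (Fin m) →L[ℝ] EuclideanSpace ℝ (Fin m) →L[ℝ] ℝ :=
  if hx : ∃ u ∈ Set.Ioo (-σ) σ ×ˢ (Set.univ : Set W), Φ u = x then
    (innerAt g (Φ (η hx.choose.1, hx.choose.2))).bilinearComp
      ((dPhi (n := n) Φ (η hx.choose.1, hx.choose.2)).comp (dPhi Φ hx.choose).inverse)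
      ((dPhi (n := n) Φ (η hx.choose.1, hx.choose.2)).comp (dPhi Φ hx.choose).inverse)
  else innerAt g x

/-- Injectivity of Φ makes the preimage chosen in `bentForm` equal to `(t, p)`. -/
theorem IsFermi.bentForm_eq (hΦ : IsFermi (n := n) g ι ν σ Φ) {t : ℝ} (ht : t ∈ Set.Ioo (-σ) σ)
    (p : W) :
    bentForm (n := n) g Φ σ η (Φ (t, p)) =
      (innerAt g (Φ (η t, p))).bilinearComp
        ((dPhi (n := n) Φ (η t, p)).comp (dPhi Φ (t, p)).inverse)
        ((dPhi (n := n) Φ (η t, p)).comp (dPhi Φ (t, p)).inverse) := by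
  have hx : ∃ u ∈ Set.Ioo (-σ) σ ×ˢ (Set.univ : Set W), Φ u = Φ (t, p) :=
    ⟨(t, p), ⟨ht, trivial⟩, rfl⟩
  have hu : hx.choose = (t, p) :=
    hΦ.injOn hx.choose_spec.1 ⟨ht, trivial⟩ hx.choose_spec.2
  rw [bentForm, dif_pos hx, hu]

theorem bentForm_of_notMem {x : H} (hx : x ∉ Φ '' (Set.Ioo (-σ) σ ×ˢ (Set.univ : Set W))) :
    bentForm (n := n) g Φ σ η x = innerAt g x := by
  rw [bentForm, dif_neg]
  exact hx

theorem IsFermi.bentForm_dPhi (hΦ : IsFermi (n := n) g ι ν σ Φ) {t : ℝ} (ht : t ∈ Set.Ioo (-σ) σ)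
    (p : W) (v w : ℝ × EuclideanSpace ℝ (Fin n)) :
    bentForm (n := n) g Φ σ η (Φ (t, p)) (dPhi Φ (t, p) v) (dPhi Φ (t, p) w) =
      innerAt g (Φ (η t, p)) (dPhi Φ (η t, p) v) (dPhi Φ (η t, p) w) := by
  have h := hΦ.isInvertible_dPhi ht p
  have h' : ∀ v, (dPhi (m := m) (n := n) Φ (t, p)).inverse (dPhi Φ (t, p) v) = v :=
    fun v => inverse_apply_apply h v
  rw [hΦ.bentForm_eq ht p, ContinuousLinearMap.bilinearComp_apply,
    ContinuousLinearMap.comp_apply, ContinuousLinearMap.comp_apply, h', h']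

theorem IsFermi.bentForm_off (hΦ : IsFermi (n := n) g ι ν σ Φ) {x : H}
    (hx : ∀ t ∈ Set.Ioo (-σ) σ, ∀ p : W, Φ (t, p) = x → η t = t) :
    bentForm (n := n) g Φ σ η x = innerAt g x := by
  by_cases h : x ∈ Φ '' (Set.Ioo (-σ) σ ×ˢ (Set.univ : Set W))
  · obtain ⟨⟨t, p⟩, ⟨ht, -⟩, rfl⟩ := h
    have hd := hΦ.isInvertible_dPhi ht p
    have h' : ∀ v, dPhi (m := m) (n := n) Φ (t, p) ((dPhi Φ (t, p)).inverse v) = v :=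
      fun v => apply_inverse_apply hd v
    rw [hΦ.bentForm_eq ht p, hx t ht p rfl]
    refine ContinuousLinearMap.ext fun v => ContinuousLinearMap.ext fun w => ?_
    rw [ContinuousLinearMap.bilinearComp_apply, ContinuousLinearMap.comp_apply,
      ContinuousLinearMap.comp_apply, h', h']
  · exact bentForm_of_notMem h

/-- Symmetry, positivity and boundedness of the unit ball are inherited from `g` through the linear
isomorphism, in both cases of the definition at once. -/
theorem IsFermi.exists_bentForm_eq (hΦ : IsFermi (n := n) g ι ν σ Φ)
    (hη : Set.MapsTo η (Set.Ioo (-σ) σ) (Set.Ioo (-σ) σ)) (x : H) :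
    ∃ (y : H) (e : EuclideanSpace ℝ (Fin m) ≃L[ℝ] EuclideanSpace ℝ (Fin m)),
      ∀ v w, bentForm (n := n) g Φ σ η x v w = innerAt g y (e v) (e w) := by
  by_cases h : x ∈ Φ '' (Set.Ioo (-σ) σ ×ˢ (Set.univ : Set W))
  · obtain ⟨⟨t, p⟩, ⟨ht, -⟩, rfl⟩ := h
    obtain ⟨a, ha⟩ := hΦ.isInvertible_dPhi ht p
    obtain ⟨b, hb⟩ := hΦ.isInvertible_dPhi (hη ht) p
    refine ⟨Φ (η t, p), a.symm.trans b, fun v w => ?_⟩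
    rw [hΦ.bentForm_eq ht p, ← ha, ← hb, ContinuousLinearMap.inverse_equiv]
    rfl
  · exact ⟨x, .refl ℝ _, fun v w => by rw [bentForm_of_notMem h]; rfl⟩

theorem IsFermi.isClosed_image [T2Space H] [CompactSpace W] (hΦ : IsFermi (n := n) g ι ν σ Φ)
    {a b : ℝ} (ha : -σ < a) (hb : b < σ) :
    IsClosed (Φ '' (Set.Icc a b ×ˢ (Set.univ : Set W))) := by
  refine ((isCompact_Icc.prod isCompact_univ).image_of_continuousOn fun u hu => ?_).isClosed
  exact (hΦ.contMDiffAt ⟨ha.trans_le hu.1.1, hu.1.2.trans_lt hb⟩ u.2).continuousAt.continuousWithinAt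

/-- Smooth metrics with `Φ^*g' = dt² + g_{η t}`. -/
theorem IsFermi.exists_bentMetric [T2Space H] [CompactSpace W]
    (hΦ : IsFermi (n := n) g ι ν σ Φ) (hη : ContDiff ℝ ∞ η)
    (hm : Set.MapsTo η (Set.Ioo (-σ) σ) (Set.Ioo (-σ) σ)) {a b : ℝ} (ha : -σ < a) (hb : b < σ)
    (hab : ∀ t, t ∉ Set.Icc a b → η t = t) :
    ∃ g' : Metric m H,
      (∀ t ∈ Set.Ioo (-σ) σ, ∀ (p : W) (v w : ℝ × EuclideanSpace ℝ (Fin n)),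
        innerAt g' (Φ (t, p)) (dPhi Φ (t, p) v) (dPhi Φ (t, p) w) =
          innerAt g (Φ (η t, p)) (dPhi Φ (η t, p) v) (dPhi Φ (η t, p) w)) ∧
      ∀ x, (∀ t ∈ Set.Ioo (-σ) σ, ∀ p : W, Φ (t, p) = x → η t = t) →
        g'.inner x = g.inner x := by
  let s : ∀ x : H, TangentSpace (𝓡 m) x →L[ℝ] TangentSpace (𝓡 m) x →L[ℝ] ℝ :=
    fun x => bentForm (n := n) g Φ σ η x
  have hs : ∀ x, ∃ (y : H) (e : EuclideanSpace ℝ (Fin m) ≃L[ℝ] EuclideanSpace ℝ (Fin m)),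
      ∀ v w, s x v w = innerAt g y (e v) (e w) := hΦ.exists_bentForm_eq hm
  refine ⟨⟨s, fun x v w => ?_, fun x v hv => ?_, fun x => ?_, fun x => ?_⟩,
    fun t ht p v w => hΦ.bentForm_dPhi ht p v w, fun x hx => hΦ.bentForm_off hx⟩
  · obtain ⟨y, e, he⟩ := hs x
    exact (he v w).trans ((g.symm y (e v) (e w)).trans (he w v).symm)
  · obtain ⟨y, e, he⟩ := hs x
    have hv' : e v ≠ 0 := fun h => hv (e.injective (h.trans (map_zero e).symm))
    exact (g.pos y (e v) hv').trans_eq (he v v).symm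
  · obtain ⟨y, e, he⟩ := hs x
    have h1 : Bornology.IsVonNBounded ℝ
        {v : EuclideanSpace ℝ (Fin m) | innerAt g y v v < 1} := g.isVonNBounded y
    have h2 := h1.image (e.symm : EuclideanSpace ℝ (Fin m) →L[ℝ] EuclideanSpace ℝ (Fin m))
    refine Bornology.IsVonNBounded.subset (fun v hv => ?_) h2
    exact ⟨e v, (he v v).symm.trans_lt hv, e.symm_apply_apply v⟩
  -- Smoothness: inside the Fermi neighbourhood the form is G(η t, y) in a Fermi chart. A point
  -- outside it also avoids the image of [a, b] × W, which is compact and hence closed in the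
  -- Hausdorff space `H`, so the form equals `g` near that point.
  · by_cases h : x ∈ Φ '' (Set.Ioo (-σ) σ ×ˢ (Set.univ : Set W))
    · obtain ⟨⟨t, p⟩, ⟨ht, -⟩, rfl⟩ := h
      set z : ℝ × EuclideanSpace ℝ (Fin n) := (t, extChartAt (𝓡 n) p p) with hzdef
      have hz : z ∈ Set.Ioo (-σ) σ ×ˢ (extChartAt (𝓡 n) p).target :=
        ⟨ht, mem_extChartAt_target p⟩
      have hx : fermiChart Φ p z = Φ (t, p) := by
        simp only [fermiChart, hzdef, extChartAt_to_inv]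
      rw [← hx]
      refine contMDiffAt_form_of_pullback (s := s) (hΦ.contMDiffAt_fermiChart hz)
        (hΦ.exists_equiv hz) ?_
      have hz' : (η z.1, z.2) ∈ Set.Ioo (-σ) σ ×ˢ (extChartAt (𝓡 n) p).target := ⟨hm hz.1, hz.2⟩
      have e1 := contDiffAt_pullback g (hΦ.contMDiffAt_fermiChart hz')
      have e2 : ContDiffAt ℝ ∞ (fun z : ℝ × EuclideanSpace ℝ (Fin n) => (η z.1, z.2)) z :=
        ((hη.comp contDiff_fst).prodMk contDiff_snd).contDiffAt
      refine (ContDiffAt.comp z e1 e2).congr_of_eventuallyEq ?_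
      have ho := (isOpen_Ioo.prod (isOpen_extChartAt_target (I := 𝓡 n) p)).mem_nhds hz
      filter_upwards [ho] with y hy
      refine ContinuousLinearMap.ext fun v => ContinuousLinearMap.ext fun w => ?_
      have hy' : (η y.1, y.2) ∈ Set.Ioo (-σ) σ ×ˢ (extChartAt (𝓡 n) p).target :=
        ⟨hm hy.1, hy.2⟩
      refine Eq.trans ?_ (hΦ.pullback_fermiChart g hy' v w).symm
      refine Eq.trans ?_ (hΦ.bentForm_dPhi hy.1 _ _ _)
      exact congrArg₂ (fun a b => bentForm (n := n) g Φ σ η (fermiChart Φ p y) a b)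
        (hΦ.mfderiv_fermiChart hy v) (hΦ.mfderiv_fermiChart hy w)
    · have hx : x ∉ Φ '' (Set.Icc a b ×ˢ (Set.univ : Set W)) := by
        rintro ⟨u, hu, rfl⟩
        exact h ⟨u, ⟨⟨ha.trans_le hu.1.1, hu.1.2.trans_lt hb⟩, trivial⟩, rfl⟩
      refine (g.contMDiff x).congr_of_eventuallyEq ?_
      filter_upwards [(hΦ.isClosed_image ha hb).isOpen_compl.mem_nhds hx] with y hy
      have : s y = g.inner y := hΦ.bentForm_off fun t ht p hp => hab t fun htab =>
        hy ⟨(t, p), ⟨htab, trivial⟩, hp⟩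
      rw [this]

theorem IsFermi.pullback_fermiChart_bent (hΦ : IsFermi (n := n) g ι ν σ Φ) {p : W}
    {z : ℝ × EuclideanSpace ℝ (Fin n)}
    (hz : z ∈ Set.Ioo (-σ) σ ×ˢ (extChartAt (𝓡 n) p).target) (hη : η z.1 ∈ Set.Ioo (-σ) σ)
    (hg : ∀ (q : W) (v w : ℝ × EuclideanSpace ℝ (Fin n)),
        innerAt g' (Φ (z.1, q)) (dPhi Φ (z.1, q) v) (dPhi Φ (z.1, q) w) =
          innerAt g (Φ (η z.1, q)) (dPhi Φ (η z.1, q) v) (dPhi Φ (η z.1, q) w)) :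
    pullback g'.inner (fermiChart Φ p) z = pullback g.inner (fermiChart Φ p) (η z.1, z.2) := by
  refine ContinuousLinearMap.ext fun v => ContinuousLinearMap.ext fun w => ?_
  have hz' : (η z.1, z.2) ∈ Set.Ioo (-σ) σ ×ˢ (extChartAt (𝓡 n) p).target := ⟨hη, hz.2⟩
  rw [hΦ.pullback_fermiChart g' hz, hg, hΦ.pullback_fermiChart g hz']

theorem scal_congr {x : H} (h : ∀ᶠ y in 𝓝 x, g'.inner y = g.inner y) : scal g' x = scal g x := by
  refine scalCoord_congr ?_
  have hc : ContinuousAt (extChartAt (𝓡 m) x).symm (extChartAt (𝓡 m) x x) :=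
    continuousAt_extChartAt_symm x
  have h' : ∀ᶠ y in 𝓝 (extChartAt (𝓡 m) x x),
      g'.inner ((extChartAt (𝓡 m) x).symm y) = g.inner ((extChartAt (𝓡 m) x).symm y) := by
    refine Filter.Tendsto.eventually (p := fun z => g'.inner z = g.inner z) hc ?_
    rwa [extChartAt_to_inv]
  filter_upwards [h'] with y hy
  rw [coordMetric, coordMetric, hy]

end Bending

/-! ### Existence of compressions -/

section Compression

open MeasureTheory

theorem contDiff_primitive {f : ℝ → ℝ} (hf : ContDiff ℝ ∞ f) (c : ℝ) :
    ContDiff ℝ ∞ (fun t => c + ∫ s in (0 : ℝ)..t, f s) ∧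
      deriv (fun t => c + ∫ s in (0 : ℝ)..t, f s) = f := by
  have h : ∀ t, HasDerivAt (fun t => c + ∫ s in (0 : ℝ)..t, f s) (f t) t := fun t =>
    (hf.continuous.integral_hasStrictDerivAt 0 t).hasDerivAt.const_add c
  have hd := deriv_eq h
  exact ⟨contDiff_infty_iff_deriv.2 ⟨fun t => (h t).differentiableAt, by rwa [hd]⟩, hd⟩

/-- A normalized exp(-1/(δ² - t²)). Monotonicity on [0, ∞) is what later yields the growth
condition, so an arbitrary bump function would not do. -/
theorem exists_even_bump {δ : ℝ} (hδ : 0 < δ) :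
    ∃ φ : ℝ → ℝ, ContDiff ℝ ∞ φ ∧ (∀ t, φ (-t) = φ t) ∧ (∀ t, 0 ≤ φ t) ∧
      (∀ t, δ ≤ t → φ t = 0) ∧ AntitoneOn φ (Set.Ici 0) ∧ ∫ s in (0 : ℝ)..δ, φ s = 1 := by
  set ψ : ℝ → ℝ := fun t => expNegInvGlue (δ ^ 2 - t ^ 2) with hψ
  have hs : ContDiff ℝ ∞ ψ := expNegInvGlue.contDiff.comp (by fun_prop)
  have hI : 0 < ∫ s in (0 : ℝ)..δ, ψ s := by
    refine intervalIntegral.intervalIntegral_pos_of_pos_on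
      (hs.continuous.intervalIntegrable _ _) (fun t ht => ?_) hδ
    exact expNegInvGlue.pos_of_pos (by nlinarith [ht.1, ht.2])
  refine ⟨fun t => ψ t / ∫ s in (0 : ℝ)..δ, ψ s, hs.div_const _, fun t => ?_, fun t => ?_,
    fun t ht => ?_, fun a ha b hb hab => ?_, ?_⟩
  · simp only [hψ, neg_sq]
  · exact div_nonneg (expNegInvGlue.nonneg _) hI.le
  · have : ψ t = 0 := expNegInvGlue.zero_of_nonpos (by nlinarith)
    simp only [this, zero_div]
  · refine div_le_div_of_nonneg_right (expNegInvGlue.monotone ?_) hI.le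
    have : 0 ≤ a := ha
    nlinarith
  · rw [intervalIntegral.integral_div, div_self hI.ne']

/-- The bump φ is h'', its odd primitive H is h', and the primitive of H, suitably shifted, is h. -/
theorem exists_isCompression {k δ : ℝ} (hδ : 0 < δ) (hk : 0 ≤ k) (hkδ : k * δ ≤ 1) :
    ∃ h, IsCompression k δ h := by
  obtain ⟨φ, hs, he, h0, hz, ha, hI⟩ := exists_even_bump hδ
  have hint : ∀ a b, IntervalIntegrable φ volume a b := fun a b =>
    hs.continuous.intervalIntegrable a b
  set H : ℝ → ℝ := fun t => 0 + ∫ s in (0 : ℝ)..t, φ s with hHdef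
  obtain ⟨hHs, hHd⟩ := contDiff_primitive hs 0
  have hHint : ∀ a b, IntervalIntegrable H volume a b := fun a b =>
    hHs.continuous.intervalIntegrable a b
  have hH0 : H 0 = 0 := by simp [hHdef]
  have hodd : ∀ t, H (-t) = -H t := fun t => by
    have := intervalIntegral.integral_comp_neg (a := 0) (b := t) φ
    simp only [he, neg_zero] at this
    simp only [hHdef, zero_add, this]
    exact intervalIntegral.integral_symm _ _
  have hmono : Monotone H := monotone_of_deriv_nonneg (hHs.differentiable (by simp)) fun t => by
    rw [hHd]; exact h0 t
  have hsub : ∀ a b, H b - H a = ∫ s in a..b, φ s := fun a b => by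
    simp only [hHdef, zero_add]
    exact intervalIntegral.integral_interval_sub_left (hint _ _) (hint _ _)
  have hδ1 : H δ = 1 := by simp only [hHdef, zero_add, hI]
  have hone : ∀ t, δ ≤ t → H t = 1 := fun t ht => by
    have h1 := hsub δ t
    rw [intervalIntegral.integral_congr (g := fun _ => (0 : ℝ)) fun s hs => ?_] at h1
    · simp only [intervalIntegral.integral_zero] at h1
      linarith
    · rw [Set.uIcc_of_le ht] at hs
      exact hz s hs.1
  have hle : ∀ t, H t ≤ 1 := fun t => by
    rcases le_total t δ with h | h
    · exact hδ1 ▸ hmono h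
    · exact (hone t h).le
  -- Since φ decreases on [t, δ], 1 - H(t) = ∫_t^δ φ ≤ (δ - t) φ(t) ≤ δ φ(t); this is where k δ ≤ 1
  -- is used.
  have hgrowth : ∀ t, 0 ≤ t → k * (1 - H t) ≤ φ t := fun t ht => by
    rcases le_total t δ with h | h
    · have h1 : 1 - H t ≤ ∫ _ in t..δ, φ t := by
        rw [← hδ1, hsub]
        exact intervalIntegral.integral_mono_on h (hint _ _) (by simp) fun s hs =>
          ha ht (ht.trans hs.1) hs.1
      rw [intervalIntegral.integral_const, smul_eq_mul] at h1
      calc k * (1 - H t) ≤ k * ((δ - t) * φ t) := mul_le_mul_of_nonneg_left h1 hk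
        _ ≤ k * (δ * φ t) := by
            refine mul_le_mul_of_nonneg_left ?_ hk
            exact mul_le_mul_of_nonneg_right (by linarith) (h0 t)
        _ = k * δ * φ t := by ring
        _ ≤ φ t := mul_le_of_le_one_left (h0 t) hkδ
    · rw [hone t h, sub_self, mul_zero]; exact h0 t
  -- The constant of integration making h(δ) = δ. It is h(0), and it is positive because H ≤ 1 with
  -- H(0) = 0.
  set c : ℝ := δ - ∫ s in (0 : ℝ)..δ, H s with hc
  have hcpos : 0 < c := by
    have : ∫ s in (0 : ℝ)..δ, H s < ∫ _ in (0 : ℝ)..δ, (1 : ℝ) :=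
      intervalIntegral.integral_lt_integral_of_continuousOn_of_le_of_exists_lt hδ
        hHs.continuous.continuousOn continuousOn_const (fun t _ => hle t)
        ⟨0, ⟨le_rfl, hδ.le⟩, by rw [hH0]; exact one_pos⟩
    rw [intervalIntegral.integral_const, smul_eq_mul, mul_one, sub_zero] at this
    linarith
  set h : ℝ → ℝ := fun t => c + ∫ s in (0 : ℝ)..t, H s with hh
  obtain ⟨hhs, hhd⟩ := contDiff_primitive hHs c
  have heven : ∀ t, h (-t) = h t := fun t => by
    have := intervalIntegral.integral_comp_neg (a := 0) (b := t) H
    simp only [hodd, neg_zero, intervalIntegral.integral_neg] at this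
    simp only [hh]
    rw [intervalIntegral.integral_symm, ← this, neg_neg]
  have hright : ∀ t, δ ≤ t → h t = t := fun t ht => by
    simp only [hh, hc]
    rw [← intervalIntegral.integral_add_adjacent_intervals (hHint 0 δ) (hHint δ t),
      intervalIntegral.integral_congr (a := δ) (g := fun _ => (1 : ℝ)) fun s hs => ?_]
    · rw [intervalIntegral.integral_const, smul_eq_mul]
      ring
    · rw [Set.uIcc_of_le ht] at hs
      exact hone s hs.1
  have hpos : ∀ t, 0 ≤ t → 0 < h t := fun t ht => by
    have : 0 ≤ ∫ s in (0 : ℝ)..t, H s := intervalIntegral.integral_nonneg ht fun s hs =>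
      hH0 ▸ hmono hs.1
    simp only [hh]
    linarith
  have hge : ∀ t, -1 ≤ H t := fun t => by
    have := hle (-t)
    rw [hodd] at this
    linarith
  have hdd : deriv (deriv h) = φ := by rw [hhd, hHd]
  refine ⟨h, hhs, fun t => ?_, fun t ht => ?_, hright, heven, fun t => ?_, fun t => ?_,
    fun t ht => ?_, fun t ht => ?_⟩
  · rcases le_total 0 t with h | h
    · exact hpos t h
    · rw [← heven]; exact hpos _ (by linarith)
  · rw [← heven]; exact hright _ (by linarith)
  · rw [hhd]; exact abs_le.2 ⟨hge t, hle t⟩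
  · rw [hdd]; exact h0 t
  · rw [hdd, hhd, abs_of_nonneg (h0 t), abs_of_nonneg (by linarith [hge t])]
    have := hgrowth (-t) (by linarith)
    rw [he, hodd] at this
    linarith
  · rw [hdd, hhd, abs_of_nonneg (h0 t), abs_of_nonpos (by linarith [hle t]), neg_sub]
    exact hgrowth t ht

end Compression

/-! ### Uniform constants over the hypersurface and construction of the replacement metric -/

section Replacement

variable {m n : ℕ}
  {H : Type*} [TopologicalSpace H] [ChartedSpace (EuclideanSpace ℝ (Fin m)) H]
  [IsManifold (𝓡 m) ∞ H]
  {W : Type*} [TopologicalSpace W] [ChartedSpace (EuclideanSpace ℝ (Fin n)) W]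
  [IsManifold (𝓡 n) ∞ W]
  {Φ : ℝ × W → H} {g g' : Metric m H} {ι : W → H} {ν : ∀ p : W, TangentSpace (𝓡 m) (ι p)}
  {σ : ℝ}

/-- At the points `Φ (t, q)`, `q ∈ s`, `0 ≤ t ≤ δ ≤ σ₁`, replacing `dt² + g_t` by `dt² + g_{h t}`
does not decrease the scalar curvature when `h` is a compression with constant at least `k₀`. -/
def ScalIncreases (g : Metric m H) (Φ : ℝ × W → H) (σ₁ k₀ : ℝ) (s : Set W) : Prop :=
  ∀ k δ : ℝ, k₀ ≤ k → δ ≤ σ₁ → ∀ h : ℝ → ℝ, IsCompression k δ h → ∀ t ∈ Set.Icc 0 δ, ∀ q ∈ s,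
    ∀ g' : Metric m H, (∀ᶠ t' in 𝓝 t, ∀ (q' : W) (v w : ℝ × EuclideanSpace ℝ (Fin n)),
        innerAt g' (Φ (t', q')) (dPhi Φ (t', q') v) (dPhi Φ (t', q') w) =
          innerAt g (Φ (h t', q')) (dPhi Φ (h t', q') v) (dPhi Φ (h t', q') w)) →
      scal g (Φ (t, q)) ≤ scal g' (Φ (t, q))

theorem ScalIncreases.mono {σ₁ σ₁' k₀ k₀' : ℝ} {s s' : Set W}
    (h : ScalIncreases (n := n) g Φ σ₁ k₀ s) (h1 : σ₁' ≤ σ₁) (h2 : k₀ ≤ k₀') (h3 : s' ⊆ s) :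
    ScalIncreases (n := n) g Φ σ₁' k₀' s' :=
  fun k δ hk hδ f hf t ht q hq g' hg' =>
    h k δ (h2.trans hk) (hδ.trans h1) f hf t ht q (h3 hq) g' hg'

theorem IsFermi.exists_scalIncreases_nhds (hΦ : IsFermi (n := n) g ι ν σ Φ) (p : W)
    (hmean : 0 < meanCurvature (n := n) g ι ν p) :
    ∃ s ∈ 𝓝 p, ∃ σ₁, 0 < σ₁ ∧ σ₁ < σ ∧ ∃ k₀, ScalIncreases (n := n) g Φ σ₁ k₀ s := by
  rw [hΦ.meanCurvature_eq p] at hmean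
  obtain ⟨N, hN, hNV, σ₁, h1, h2, k₀, hk⟩ := exists_scalCoord_le_warp hΦ.pos
    (isOpen_extChartAt_target (I := 𝓡 n) p) (mem_extChartAt_target p)
    (fun z hz => contDiffAt_pullback g (hΦ.contMDiffAt_fermiChart hz))
    (fun z hz => hΦ.isFermiForm hz) (by linarith)
  refine ⟨(extChartAt (𝓡 n) p).source ∩ extChartAt (𝓡 n) p ⁻¹' N,
    Filter.inter_mem (extChartAt_source_mem_nhds p) ((continuousAt_extChartAt p) hN),
    σ₁, h1, h2, k₀, fun k δ hk₀ hδ h hh t ht q hq g' hg' => ?_⟩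
  obtain ⟨-, -, htt, hhδ, -⟩ := hh.estimates ht
  set y := extChartAt (𝓡 n) p q with hy
  have hyV : y ∈ (extChartAt (𝓡 n) p).target := hNV hq.2
  have htσ : t ∈ Set.Ioo (-σ) σ := ⟨by linarith [ht.1], by linarith [ht.2]⟩
  have hz : (t, y) ∈ Set.Ioo (-σ) σ ×ˢ (extChartAt (𝓡 n) p).target := ⟨htσ, hyV⟩
  have hx : fermiChart Φ p (t, y) = Φ (t, q) := by
    simp only [fermiChart, hy, (extChartAt (𝓡 n) p).left_inv hq.1]
  have e1 := scal_eq_scalCoord_pullback g (hΦ.contMDiffAt_fermiChart hz) (hΦ.exists_equiv hz)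
  have e2 := scal_eq_scalCoord_pullback g' (hΦ.contMDiffAt_fermiChart hz) (hΦ.exists_equiv hz)
  rw [← hx, e1, e2]
  refine (hk k δ hk₀ hδ h hh t ht y hq.2).trans_eq (scalCoord_congr ?_)
  have c1 : ∀ᶠ z : ℝ × EuclideanSpace ℝ (Fin n) in 𝓝 (t, y), h z.1 ∈ Set.Ioo (-σ) σ := by
    have : ContinuousAt (fun z : ℝ × EuclideanSpace ℝ (Fin n) => h z.1) (t, y) :=
      (hh.smooth.continuous.comp continuous_fst).continuousAt
    exact this (isOpen_Ioo.mem_nhds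
      ⟨by change -σ < h t; linarith [ht.1], by change h t < σ; linarith⟩)
  have c2 := (continuousAt_fst (p := (t, y))).eventually hg'
  filter_upwards [c1, c2,
    (isOpen_Ioo.prod (isOpen_extChartAt_target (I := 𝓡 n) p)).mem_nhds hz] with z z1 z2 z3
  exact (hΦ.pullback_fermiChart_bent z3 z1 z2).symm

/-- Induction over the compact space `W`: a union is handled by the smaller width and the larger
threshold. -/
theorem IsFermi.exists_scalIncreases [CompactSpace W] (hΦ : IsFermi (n := n) g ι ν σ Φ)
    (hmean : ∀ p : W, 0 < meanCurvature (n := n) g ι ν p) :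
    ∃ σ₁, 0 < σ₁ ∧ σ₁ < σ ∧ ∃ k₀, ScalIncreases (n := n) g Φ σ₁ k₀ Set.univ := by
  refine isCompact_univ.induction_on
    (p := fun s => ∃ σ₁, 0 < σ₁ ∧ σ₁ < σ ∧ ∃ k₀, ScalIncreases (n := n) g Φ σ₁ k₀ s)
    ?_ ?_ ?_ ?_
  · exact ⟨σ / 2, by linarith [hΦ.pos], by linarith [hΦ.pos], 0,
      fun _ _ _ _ _ _ _ _ _ hq => hq.elim⟩
  · rintro s t hst ⟨σ₁, h1, h2, k₀, h⟩
    exact ⟨σ₁, h1, h2, k₀, h.mono le_rfl le_rfl hst⟩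
  · rintro s t ⟨a, ha, ha', k, hs⟩ ⟨b, hb, hb', l, ht⟩
    refine ⟨min a b, lt_min ha hb, (min_le_left _ _).trans_lt ha', max k l, ?_⟩
    intro k' δ hk hδ f hf u hu q hq
    rcases hq with hq | hq
    · exact (hs.mono (min_le_left _ _) (le_max_left _ _) subset_rfl) k' δ hk hδ f hf u hu q hq
    · exact (ht.mono (min_le_right _ _) (le_max_right _ _) subset_rfl) k' δ hk hδ f hf u hu q hq
  · intro p _
    obtain ⟨s, hs, h⟩ := hΦ.exists_scalIncreases_nhds p (hmean p)
    exact ⟨s, mem_nhdsWithin_of_mem_nhds hs, h⟩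

/-- A function that is `h` for `t ≥ 0` and the identity for `t` below `-δ/2`. -/
theorem IsCompression.exists_extension {k δ σ : ℝ} {h : ℝ → ℝ} (hh : IsCompression k δ h)
    (hδ : 0 < δ) (hσ : δ < σ) :
    ∃ η : ℝ → ℝ, ContDiff ℝ ∞ η ∧ Set.MapsTo η (Set.Ioo (-σ) σ) (Set.Ioo (-σ) σ) ∧
      (∀ t, t ∉ Set.Icc (-(δ / 2)) δ → η t = t) ∧ η δ = δ ∧ ∀ t, 0 ≤ t → η =ᶠ[𝓝 t] h := by
  -- The cutoff climbs from 0 at -δ/2 to 1 at -δ/4. Thus η agrees with h on both sides of 0, so that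
  -- curvature and second fundamental form at t = 0 are those computed from h.
  set χ : ℝ → ℝ := fun t => Real.smoothTransition (4 / δ * t + 2) with hχ
  have hχs : ContDiff ℝ ∞ χ := Real.smoothTransition.contDiff.comp (by fun_prop)
  have hχ0 : ∀ t, t ≤ -(δ / 2) → χ t = 0 := fun t ht => by
    refine Real.smoothTransition.zero_of_nonpos ?_
    have : 4 / δ * t ≤ 4 / δ * -(δ / 2) := mul_le_mul_of_nonneg_left ht (by positivity)
    have e : 4 / δ * -(δ / 2) = -2 := by field_simp; norm_num
    linarith
  have hχ1 : ∀ t, -(δ / 4) ≤ t → χ t = 1 := fun t ht => by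
    refine Real.smoothTransition.one_of_one_le ?_
    have : 4 / δ * -(δ / 4) ≤ 4 / δ * t := mul_le_mul_of_nonneg_left ht (by positivity)
    have e : 4 / δ * -(δ / 4) = -1 := by field_simp
    linarith
  have hη1 : ∀ t, -(δ / 4) ≤ t → χ t * h t + (1 - χ t) * t = h t := fun t ht => by
    rw [hχ1 t ht]; ring
  have hoff : ∀ t, t ∉ Set.Icc (-(δ / 2)) δ → χ t * h t + (1 - χ t) * t = t := fun t ht => by
    rcases lt_or_ge t (-(δ / 2)) with h1 | h1
    · rw [hχ0 t h1.le]; ring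
    · have h2 : δ < t := not_le.1 fun h2 => ht ⟨h1, h2⟩
      rw [hη1 t (by linarith), hh.right t h2.le]
  have hb : ∀ t ∈ Set.Icc (-δ) δ, 0 < h t ∧ h t ≤ δ := fun t ht => by
    refine ⟨hh.pos t, ?_⟩
    rcases le_total 0 t with h0 | h0
    · exact (hh.estimates ⟨h0, ht.2⟩).2.2.2.1
    · rw [← hh.even]
      exact (hh.estimates ⟨by linarith, by linarith [ht.1]⟩).2.2.2.1
  refine ⟨fun t => χ t * h t + (1 - χ t) * t, ?_, fun t ht => ?_, hoff, ?_, fun t ht => ?_⟩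
  · exact (hχs.mul hh.smooth).add ((contDiff_const.sub hχs).mul contDiff_id)
  · by_cases hI : t ∈ Set.Icc (-(δ / 2)) δ
    · obtain ⟨h1, h2⟩ := hb t ⟨by linarith [hI.1], hI.2⟩
      have c1 : 0 ≤ χ t := Real.smoothTransition.nonneg _
      have c2 : χ t ≤ 1 := Real.smoothTransition.le_one _
      exact (convex_Ioo (-σ) σ) ⟨by linarith, by linarith⟩ ht c1 (sub_nonneg.2 c2) (by ring)
    · change χ t * h t + (1 - χ t) * t ∈ _
      rwa [hoff t hI]
  · exact (hη1 δ (by linarith)).trans (hh.right δ le_rfl)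
  · filter_upwards [Ioi_mem_nhds (show -(δ / 4) < t by linarith)] with s hs
    exact hη1 s (le_of_lt hs)

theorem IsFermi.isReplacement (hΦ : IsFermi (n := n) g ι ν σ Φ) {δ : ℝ} {h : ℝ → ℝ}
    (hh : ∀ t ∈ Set.Ico 0 σ, h t ∈ Set.Ioo (-σ) σ)
    (hg : ∀ t ∈ Set.Ico 0 σ, ∀ (p : W) (v w : ℝ × EuclideanSpace ℝ (Fin n)),
      innerAt g' (Φ (t, p)) (dPhi Φ (t, p) v) (dPhi Φ (t, p) w) =
        innerAt g (Φ (h t, p)) (dPhi Φ (h t, p) v) (dPhi Φ (h t, p) w))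
    (hoff : ∀ x, x ∉ Φ '' (Set.Ioo (-δ) δ ×ˢ Set.univ) → g'.inner x = g.inner x) :
    IsReplacement (n := n) g Φ σ δ h g' := by
  refine ⟨fun t ht p => ?_, hoff⟩
  have ht' : t ∈ Set.Ioo (-σ) σ := ⟨by linarith [ht.1, hΦ.pos], ht.2⟩
  have hd := hΦ.mdifferentiableAt ht' p
  have hd' := hΦ.mdifferentiableAt (hh t ht) p
  have e1 := dt_eq_dPhi hd
  refine ⟨?_, fun v => ?_, fun v w => ?_⟩
  · refine (congrArg₂ (fun a b => innerAt g' (Φ (t, p)) a b) e1 e1).trans ?_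
    rw [hg t ht, hΦ.innerAt_dPhi (hh t ht)]
  · refine (congrArg₂ (fun a b => innerAt g' (Φ (t, p)) a b) e1 (dslice_eq_dPhi hd v)).trans ?_
    rw [hg t ht, hΦ.innerAt_dPhi (hh t ht)]
  · refine (congrArg₂ (fun a b => innerAt g' (Φ (t, p)) a b) (dslice_eq_dPhi hd v)
      (dslice_eq_dPhi hd w)).trans ?_
    rw [hg t ht]
    exact (congrArg₂ (fun a b => innerAt g (Φ (h t, p)) a b) (dslice_eq_dPhi hd' v)
      (dslice_eq_dPhi hd' w)).symm

/-- By the chain rule the t-derivative of G(h(t), y) carries the factor h'(0) = 0. -/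
theorem IsFermi.isTotallyGeodesic_bent (hΦ : IsFermi (n := n) g ι ν σ Φ) {h : ℝ → ℝ}
    (hh : DifferentiableAt ℝ h 0) (hh0 : deriv h 0 = 0) (hσ : h 0 ∈ Set.Ioo (-σ) σ)
    (hg : ∀ᶠ t in 𝓝 (0 : ℝ), ∀ (p : W) (v w : ℝ × EuclideanSpace ℝ (Fin n)),
      innerAt g' (Φ (t, p)) (dPhi Φ (t, p) v) (dPhi Φ (t, p) w) =
        innerAt g (Φ (h t, p)) (dPhi Φ (h t, p) v) (dPhi Φ (h t, p) w)) :
    IsTotallyGeodesic (n := n) g' ι := by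
  have key : ∀ p : W, ∀ᶠ z in 𝓝 ((0 : ℝ), extChartAt (𝓡 n) p p),
      (h z.1, z.2) ∈ Set.Ioo (-σ) σ ×ˢ (extChartAt (𝓡 n) p).target ∧
      pullback g'.inner (fermiChart Φ p) z = pullback g.inner (fermiChart Φ p) (h z.1, z.2) := by
    intro p
    have hz : ((0 : ℝ), extChartAt (𝓡 n) p p) ∈
        Set.Ioo (-σ) σ ×ˢ (extChartAt (𝓡 n) p).target :=
      ⟨hΦ.zero_mem, mem_extChartAt_target p⟩
    have c1 : ContinuousAt (fun z : ℝ × EuclideanSpace ℝ (Fin n) => h z.1)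
        ((0 : ℝ), extChartAt (𝓡 n) p p) :=
      ContinuousAt.comp (g := h) (f := Prod.fst) hh.continuousAt continuousAt_fst
    filter_upwards [c1 (isOpen_Ioo.mem_nhds hσ),
      (continuousAt_fst (p := ((0 : ℝ), extChartAt (𝓡 n) p p))).eventually hg,
      (isOpen_Ioo.prod (isOpen_extChartAt_target (I := 𝓡 n) p)).mem_nhds hz] with z z1 z2 z3
    exact ⟨⟨z1, z3.2⟩, hΦ.pullback_fermiChart_bent z3 z1 z2⟩
  refine hΦ.isTotallyGeodesic g' (fun p => ?_) fun p => ?_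
  · filter_upwards [key p] with z hz
    have := hΦ.isFermiForm hz.1
    rw [IsFermiForm] at this ⊢
    rwa [hz.2]
  · have hz := (key p).self_of_nhds.1
    have hG := (contDiffAt_pullback g (hΦ.contMDiffAt_fermiChart hz)).differentiableAt (by simp)
    have e : pullback g'.inner (fermiChart Φ p) =ᶠ[𝓝 ((0 : ℝ), extChartAt (𝓡 n) p p)]
        fun z => pullback g.inner (fermiChart Φ p) (h z.1, z.2) := (key p).mono fun z hz => hz.2
    rw [e.fderiv_eq, fderiv_warp hh hG, ContinuousLinearMap.comp_apply, hh0, stretch_apply]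
    simp only [zero_mul]
    exact map_zero _

theorem IsFermi.exists_isReplacement [T2Space H] [CompactSpace W]
    (hΦ : IsFermi (n := n) g ι ν σ Φ) {σ₁ k₀ k δ : ℝ} {h : ℝ → ℝ} (hσ₁ : σ₁ < σ)
    (hs : ScalIncreases (n := n) g Φ σ₁ k₀ Set.univ) (hk : k₀ ≤ k) (hδ : 0 < δ) (hδσ : δ ≤ σ₁)
    (hh : IsCompression k δ h) :
    ∃ g' : Metric m H, IsReplacement (n := n) g Φ σ δ h g' ∧
      (∀ x, x ∉ Φ '' (Set.Ioo (-δ) 0 ×ˢ (Set.univ : Set W)) → scal g x ≤ scal g' x) ∧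
      IsTotallyGeodesic (n := n) g' ι := by
  obtain ⟨η, hηs, hηm, hηoff, hηδ, hηh⟩ := hh.exists_extension hδ (hδσ.trans_lt hσ₁)
  obtain ⟨g', hg', hoff⟩ := hΦ.exists_bentMetric hηs hηm (a := -(δ / 2)) (b := δ)
    (by linarith) (by linarith) hηoff
  have hη : ∀ t, 0 ≤ t → η t = h t := fun t ht => (hηh t ht).self_of_nhds
  have hev : ∀ t, 0 ≤ t → t < σ →
      ∀ᶠ t' in 𝓝 t, ∀ (q : W) (v w : ℝ × EuclideanSpace ℝ (Fin n)),
        innerAt g' (Φ (t', q)) (dPhi Φ (t', q) v) (dPhi Φ (t', q) w) =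
          innerAt g (Φ (h t', q)) (dPhi Φ (h t', q) v) (dPhi Φ (h t', q) w) := by
    intro t ht htσ
    filter_upwards [hηh t ht, Ioo_mem_nhds (show -σ < t by linarith [hΦ.pos]) htσ] with s h1 h2
    intro q v w
    rw [← h1, hg' s h2]
  have hmem : ∀ t ∈ Set.Ico 0 σ, h t ∈ Set.Ioo (-σ) σ := fun t ht => by
    rw [← hη t ht.1]
    exact hηm ⟨by linarith [ht.1, hΦ.pos], ht.2⟩
  refine ⟨g', hΦ.isReplacement hmem (fun t ht => (hev t ht.1 ht.2).self_of_nhds)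
    fun x hx => hoff x fun t _ p hp => ?_, fun x hx => ?_,
    hΦ.isTotallyGeodesic_bent (hh.smooth.differentiable (by simp) 0) hh.deriv_odd
      (hmem 0 ⟨le_rfl, hΦ.pos⟩) (hev 0 le_rfl hΦ.pos)⟩
  -- The endpoint δ lies in the closed interval where η may differ from the identity, but not in the
  -- open region where the metric may change; η δ = δ covers it.
  · by_cases ht : t = δ
    · rw [ht, hηδ]
    · exact hηoff t fun h' => hx ⟨(t, p), ⟨⟨by linarith [h'.1], lt_of_le_of_ne h'.2 ht⟩,
        trivial⟩, hp⟩
  -- Excluding the discarded strip leaves 0 ≤ t ≤ δ here, where the uniform estimate applies; off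
  -- this closed set g' equals g on a neighbourhood.
  · by_cases hx' : x ∈ Φ '' (Set.Icc (-(δ / 2)) δ ×ˢ (Set.univ : Set W))
    · obtain ⟨⟨t, p⟩, ⟨ht, -⟩, rfl⟩ := hx'
      have ht0 : 0 ≤ t := not_lt.1 fun h0 =>
        hx ⟨(t, p), ⟨⟨by linarith [ht.1], h0⟩, trivial⟩, rfl⟩
      exact hs k δ hk hδσ h hh t ⟨ht0, ht.2⟩ p trivial g' (hev t ht0 (by linarith [ht.2]))
    · refine (scal_congr ?_).ge
      have hc := hΦ.isClosed_image (a := -(δ / 2)) (b := δ) (by linarith) (by linarith)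
      filter_upwards [hc.isOpen_compl.mem_nhds hx'] with y hy
      exact hoff y fun t _ p hp => hηoff t fun h' => hy ⟨(t, p), ⟨h', trivial⟩, hp⟩

/-- A tube-lemma argument: compactness of `W` gives one ε that works for all normal segments. -/
theorem IsFermi.exists_image_subset [CompactSpace W] (hΦ : IsFermi (n := n) g ι ν σ Φ) {U : Set H}
    (hU : U ∈ 𝓝ˢ (Set.range ι)) :
    ∃ ε, 0 < ε ∧ ∀ δ, δ ≤ ε → Φ '' (Set.Ioo (-δ) δ ×ˢ (Set.univ : Set W)) ⊆ U := by
  have h1 : ∀ᶠ t in 𝓝 (0 : ℝ), ∀ p ∈ (Set.univ : Set W), Φ (t, p) ∈ U := by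
    refine isCompact_univ.eventually_forall_of_forall_eventually fun p _ => ?_
    have hp : U ∈ 𝓝 (Φ (0, p)) :=
      mem_nhdsSet_iff_forall.1 hU _ ⟨p, congrFun hΦ.apply_zero p⟩
    exact (hΦ.contMDiffAt hΦ.zero_mem p).continuousAt hp
  obtain ⟨ε, hε, h2⟩ := Metric.eventually_nhds_iff.1 h1
  refine ⟨ε, hε, fun δ hδ => ?_⟩
  rintro _ ⟨⟨t, p⟩, ⟨ht, -⟩, rfl⟩
  refine h2 ?_ p trivial
  rw [Real.dist_eq, sub_zero]
  exact (abs_lt.2 ht).trans_le hδ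

end Replacement

end FermiDoubling

end

theorem mainTheorem6 {n : ℕ}
    {H : Type*} [TopologicalSpace H] [T2Space H]
    [ChartedSpace (EuclideanSpace ℝ (Fin (n + 1))) H] [IsManifold (𝓡 (n + 1)) ∞ H]
    {W : Type*} [TopologicalSpace W] [CompactSpace W]
    [ChartedSpace (EuclideanSpace ℝ (Fin n)) W] [IsManifold (𝓡 n) ∞ W]
    (g : FermiDoubling.Metric (n + 1) H)
    (ι : W → H) (_hι : Manifold.IsSmoothEmbedding (𝓡 n) (𝓡 (n + 1)) ∞ ι)
    (ν : ∀ p : W, TangentSpace (𝓡 (n + 1)) (ι p))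
    (hmean : ∀ p : W, 0 < FermiDoubling.meanCurvature (n := n) g ι ν p)
    (σ : ℝ) (Φ : ℝ × W → H) (hΦ : FermiDoubling.IsFermi (n := n) g ι ν σ Φ) :
    ∃ σ₁ : ℝ, 0 < σ₁ ∧ σ₁ ≤ σ ∧ ∃ k₀ : ℝ, 0 < k₀ ∧ ∀ k : ℝ, k₀ ≤ k →
      (∀ (δ : ℝ) (h : ℝ → ℝ), 0 < δ → δ < σ₁ / 2 → FermiDoubling.IsCompression k δ h →
        ∃ g' : FermiDoubling.Metric (n + 1) H,
          FermiDoubling.IsReplacement (n := n) g Φ σ δ h g' ∧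
          (∀ x, x ∉ Φ '' (Set.Ioo (-δ) 0 ×ˢ Set.univ) →
            FermiDoubling.scal g x ≤ FermiDoubling.scal g' x) ∧
          FermiDoubling.IsTotallyGeodesic (n := n) g' ι) ∧
      (∀ U ∈ 𝓝ˢ (Set.range ι), ∃ (δ : ℝ) (h : ℝ → ℝ) (g' : FermiDoubling.Metric (n + 1) H),
          0 < δ ∧ δ < σ₁ / 2 ∧ FermiDoubling.IsCompression k δ h ∧
          FermiDoubling.IsReplacement (n := n) g Φ σ δ h g' ∧
          (∀ x, x ∉ Φ '' (Set.Ioo (-δ) 0 ×ˢ Set.univ) →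
            FermiDoubling.scal g x ≤ FermiDoubling.scal g' x) ∧
          FermiDoubling.IsTotallyGeodesic (n := n) g' ι ∧
          ∀ x, x ∉ U → g'.inner x = g.inner x) := by
  obtain ⟨σ₁, h1, h2, k₀, hs⟩ := hΦ.exists_scalIncreases hmean
  refine ⟨σ₁, h1, h2.le, max k₀ 1, by positivity, fun k hk => ?_⟩
  have hk₀ : k₀ ≤ k := (le_max_left _ _).trans hk
  have hk1 : 1 ≤ k := (le_max_right _ _).trans hk
  refine ⟨fun δ h hδ hδ' hh =>
    hΦ.exists_isReplacement h2 hs hk₀ hδ (by linarith) hh, fun U hU => ?_⟩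
  obtain ⟨ε, hε, hεU⟩ := hΦ.exists_image_subset hU
  -- Small enough to stay in `U`, strictly below σ₁/2, and with k δ ≤ 1 so that a compression
  -- exists; the threshold `max k₀ 1` guarantees k > 0.
  set δ := min ε (min (σ₁ / 3) (1 / k)) with hδdef
  have hδ : 0 < δ := by positivity
  have hδ1 : δ ≤ σ₁ / 3 := (min_le_right _ _).trans (min_le_left _ _)
  have hδk : k * δ ≤ 1 := by
    have : k * δ ≤ k * (1 / k) :=
      mul_le_mul_of_nonneg_left ((min_le_right _ _).trans (min_le_right _ _)) (by linarith)
    rwa [mul_one_div_cancel (by linarith)] at this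
  obtain ⟨h, hh⟩ := FermiDoubling.exists_isCompression hδ (by linarith) hδk
  obtain ⟨g', hr, hsc, hg⟩ := hΦ.exists_isReplacement h2 hs hk₀ hδ (by linarith) hh
  exact ⟨δ, h, g', hδ, by linarith, hh, hr, hsc, hg, fun x hx => hr.eq_off x fun hx' =>
    hx (hεU δ (min_le_left _ _) hx')⟩
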